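/- Let $\mathcal{O}$ be a discrete valuation ring, let $A$ be a commutative noetherian local ring, and let $\lambda\colon A\to\mathcal{O}$ be a surjective ring map with kernel $\mathfrak{p}_A$ such that the $\mathcal{O}$-module $\mathfrak{p}_A/\mathfrak{p}_A^2$ has finite length. For an $A$-module $M$ and an ideal $\mathfrak{a}$ of $A$ put $M[\mathfrak{a}]=\{m\in M\mid \mathfrak{a}m=0\}$, and put $I_A=A[\mathfrak{p}_A]$. For a finitely generated $A$-module $M$ define its Wiles defect to be the integer $$\delta_A(M)=\operatorname{rank}_{\mathcal{O}}(M[\mathfrak{p}_A])\cdot \operatorname{length}_{\mathcal{O}}(\mathfrak{p}_A/\mathfrak{p}_A^2)-\operatorname{length}_{\mathcal{O}}\bigl(M/(M[\mathfrak{p}_A]+M[I_A])\bigr),$$ and let $$e_A(M)=\lim_{n\to\infty}\frac{(\dim A)!}{n^{\dim A}}\operatorname{length}_A(M/\mathfrak{m}_A^nM),\qquad e(A)=e_A(A),$$ be the Hilbert–Samuel multiplicity with respect to the maximal ideal $\mathfrak{m}_A$ of $A$. Suppose that $A$ is Gorenstein (that is, $A$ has finite injective dimension as a module over itself) and that $M$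 is a finitely generated $A$-module with $\operatorname{depth}_AM\ge 1$ (the zero module, of depth $\infty$, is allowed). Set $d=\operatorname{rank}_{\mathcal{O}}M[\mathfrak{p}_A]$. Then the $A$-module $M$ is free if and only if $$\delta_A(M)\le d\cdot\delta_A(A)\qquad\text{and}\qquad e_A(M)\le d\cdot e(A).$$ In particular, if $\delta_A(M)=d\cdot\delta_A(A)$ and $M$ has rank at most $d$ at each generic point of $A$, that is, $\dim_{\kappa(\mathfrak{q})}(\kappa(\mathfrak{q})\otimes_AM)\le d$ for every minimal prime $\mathfrak{q}$ of $A$ with residue field $\kappa(\mathfrak{q})$, then $M$ is free. -/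

import Mathlib

open scoped TensorProduct

universe u v w x

noncomputable section

namespace WilesDefect



section Augmented

variable {A : Type u} {O : Type v} [CommRing A] [CommRing O]

/-- The kernel `𝔭_A` of the augmentation `lam : A → O`. -/
def augIdeal (lam : A →+* O) : Ideal A := RingHom.ker lam

/-- The natural `O`-module structure on an `A`-module `X` with `𝔭_A X = 0`, obtained by
identifying `A ⧸ 𝔭_A` with `O` through the surjection `lam`. -/
abbrev augModule (lam : A →+* O) (hlam : Function.Surjective lam)
    (X : Type x) [AddCommGroup X] [Module A X]
    (hX : Module.IsTorsionBySet A X (augIdeal lam : Set A)) : Module O X :=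
  letI : Module (A ⧸ RingHom.ker lam) X := hX.module
  Module.compHom X (RingHom.quotientKerEquivOfSurjective hlam).symm.toRingHom

/-- Sanity check: the `O`-module structure of `augModule` is the one with
`lam a • m = a • m` for all `a` in `A`. -/
theorem augModule_smul (lam : A →+* O) (hlam : Function.Surjective lam)
    (X : Type x) [AddCommGroup X] [Module A X]
    (hX : Module.IsTorsionBySet A X (augIdeal lam : Set A)) (a : A) (m : X) :
    (letI := augModule lam hlam X hX; lam a • m) = a • m := by
  let : Module (A ⧸ RingHom.ker lam) X := hX.module
  change (RingHom.quotientKerEquivOfSurjective hlam).symm (lam a) • m = a • m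
  have h : (RingHom.quotientKerEquivOfSurjective hlam).symm (lam a)
      = Ideal.Quotient.mk (RingHom.ker lam) a := by
    rw [RingEquiv.symm_apply_eq]
    rfl
  rw [h]
  rfl

/-- The length over `O` of an `A`-module annihilated by `𝔭_A`. -/
def lengthO (lam : A →+* O) (hlam : Function.Surjective lam)
    (X : Type x) [AddCommGroup X] [Module A X]
    (hX : Module.IsTorsionBySet A X (augIdeal lam : Set A)) : ℕ∞ :=
  letI := augModule lam hlam X hX
  Module.length O X

/-- The rank over `O` of an `A`-module annihilated by `𝔭_A`. -/
def rankO (lam : A →+* O) (hlam : Function.Surjective lam)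
    (X : Type x) [AddCommGroup X] [Module A X]
    (hX : Module.IsTorsionBySet A X (augIdeal lam : Set A)) : ℕ :=
  letI := augModule lam hlam X hX
  Module.finrank O X

/-- `I_A = A[𝔭_A]`, the annihilator of `𝔭_A` in `A`. -/
def annIdeal (lam : A →+* O) : Ideal A :=
  Submodule.torsionBySet A A (augIdeal lam : Set A)

/-- The congruence module `Ψ_A(M) = M / (M[𝔭_A] + M[I_A])`. -/
abbrev CongruenceModule (lam : A →+* O) (M : Type w) [AddCommGroup M] [Module A M] : Type w :=
  M ⧸ (Submodule.torsionBySet A M (augIdeal lam : Set A) ⊔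
    Submodule.torsionBySet A M (annIdeal lam : Set A))

theorem isTorsion_conormal (lam : A →+* O) :
    Module.IsTorsionBySet A (augIdeal lam).Cotangent (augIdeal lam : Set A) := by
  rintro y ⟨a, ha⟩
  obtain ⟨z, rfl⟩ := (augIdeal lam).toCotangent_surjective y
  change a • (augIdeal lam).toCotangent z = 0
  rw [← map_smul, Ideal.toCotangent_eq_zero]
  change a * (z : A) ∈ _
  rw [pow_two]
  exact Ideal.mul_mem_mul ha z.2

theorem isTorsion_torsion (lam : A →+* O) (M : Type w) [AddCommGroup M] [Module A M] :
    Module.IsTorsionBySet A (Submodule.torsionBySet A M (augIdeal lam : Set A))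
      (augIdeal lam : Set A) :=
  Submodule.torsionBySet_isTorsionBySet _

theorem isTorsion_congruence (lam : A →+* O) (M : Type w) [AddCommGroup M] [Module A M] :
    Module.IsTorsionBySet A (CongruenceModule lam M) (augIdeal lam : Set A) := by
  rintro y ⟨a, ha⟩
  obtain ⟨m, rfl⟩ := Submodule.Quotient.mk_surjective _ y
  change a • Submodule.Quotient.mk m = 0
  rw [← Submodule.Quotient.mk_smul, Submodule.Quotient.mk_eq_zero]
  refine Submodule.mem_sup_right ?_
  rw [Submodule.mem_torsionBySet_iff]
  rintro ⟨b, hb⟩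
  change b ∈ Submodule.torsionBySet A A _ at hb
  rw [Submodule.mem_torsionBySet_iff] at hb
  have h : a * b = 0 := hb ⟨a, ha⟩
  change b • a • m = 0
  rw [smul_smul, mul_comm, h, zero_smul]

/-- The pair `(A, lam)` is an object of the category `C_O`: the map `lam : A → O` is surjective
and the conormal module `𝔭_A / 𝔭_A²` has finite length over `O`. (That `A` is a noetherian local
ring and `O` a discrete valuation ring are assumed separately as type classes.) -/
structure IsObj (lam : A →+* O) : Prop where
  surjective : Function.Surjective lam
  conormal_finite : lengthO lam surjective (augIdeal lam).Cotangent (isTorsion_conormal lam) ≠ ⊤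

/-- `rank_O M[𝔭_A]`. -/
def torsionRank {lam : A →+* O} (h : IsObj lam) (M : Type w) [AddCommGroup M] [Module A M] : ℕ :=
  rankO lam h.surjective (Submodule.torsionBySet A M (augIdeal lam : Set A))
    (isTorsion_torsion lam M)

/-- The Wiles defect
`δ_A(M) = rank_O M[𝔭_A] · length_O (𝔭_A / 𝔭_A²) - length_O Ψ_A(M)`, an integer. Both lengths are
finite for `(A, lam)` in `C_O` and `M` finitely generated over the noetherian ring `A`. -/
def wilesDefect {lam : A →+* O} (h : IsObj lam) (M : Type w) [AddCommGroup M] [Module A M] : ℤ :=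
  (torsionRank h M : ℤ) *
      ((lengthO lam h.surjective (augIdeal lam).Cotangent (isTorsion_conormal lam)).toNat : ℤ) -
    ((lengthO lam h.surjective (CongruenceModule lam M) (isTorsion_congruence lam M)).toNat : ℤ)

end Augmented

section Local

variable (A : Type u) [CommRing A]

/-- A (noetherian local) ring is Gorenstein if it has finite injective dimension as a module
over itself. -/
def IsGorenstein : Prop :=
  CategoryTheory.injectiveDimension (ModuleCat.of A A) ≠ ⊤

variable [IsLocalRing A] (M : Type w) [AddCommGroup M] [Module A M]

/-- The depth of a (finitely generated) module over a (noetherian) local ring: the supremum of the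
lengths of regular sequences on `M` in the maximal ideal; the zero module has depth `∞`. -/
def depth : ℕ∞ :=
  ⨆ (rs : List A) (_ : (∀ r ∈ rs, r ∈ IsLocalRing.maximalIdeal A) ∧
    RingTheory.Sequence.IsWeaklyRegular M rs), (rs.length : ℕ∞)

/-- The Krull dimension of a noetherian local ring, as a natural number. -/
def dimNat : ℕ := ((ringKrullDim A).unbotD 0).toNat

/-- The Hilbert–Samuel multiplicity of a finitely generated module over a noetherian local ring `A`
with respect to the maximal ideal `𝔪`, normalized by `D = dim A`:
`e_A(M) = lim_n D! · length_A (M / 𝔪ⁿ M) / n ^ D`. -/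
def hsMultiplicity : ℝ :=
  Filter.limUnder Filter.atTop fun n : ℕ =>
    ((dimNat A).factorial : ℝ) *
      ((Module.length A
        (M ⧸ (IsLocalRing.maximalIdeal A ^ n • (⊤ : Submodule A M)))).toNat : ℝ) /
      (n : ℝ) ^ dimNat A

end Local

/-- The rank of `M` at a point `q` of `Spec A`: the dimension of the fibre `M ⊗ κ(q)` over the
residue field `κ(q)`, that is, the minimal number of generators of `M_q` over `A_q`. -/
def rankAt {A : Type u} [CommRing A] (q : PrimeSpectrum A)
    (M : Type w) [AddCommGroup M] [Module A M] : ℕ :=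
  Module.finrank q.asIdeal.ResidueField (q.asIdeal.ResidueField ⊗[A] M)

end WilesDefect

end

/-!
Write `𝔭` for the kernel of `A → O` and `𝔪` for the maximal ideal of `A`.

*The ring.* Since `𝔭 ⧸ 𝔭²` has finite length, the determinant trick produces an `s ∉ 𝔭` with
`s 𝔭 = 0`, so `𝔭 = Ann s` is an associated prime of `A`. Finite injective dimension means that
`Ext^n(-, A)` vanishes for large `n`. If a finitely generated module `T` contains the residue field
and `Ext^n(T, A) = 0`, then the vanishing of `Ext^{n+1}(-, A)` on finitely generated modules
descends to `n` (`subsingleton_ext_of_succ`). With `T = A` this rules out depth zero, for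
then `A` would be self-injective and all its associated primes maximal. With `T = A ⧸ (x)`, `x`
regular, the vanishing descends to `Ext²(-, A)`, and so `A ⧸ (x)` is self-injective
(`IsObj.exists_isSMulRegular_and_baer`). Hence `A ⧸ (x)` is artinian, `dim A = 1`, and the socle of
`A ⧸ (x)` lies in every nonzero ideal of it. Moreover `A[𝔭]` is generated by a single element, which
is now called `s`.

*The Wiles defect.* As `depth M ≥ 1`, the module `M[𝔭]` is free over `A ⧸ 𝔭 = O`. Multiplication by
`s` embeds the congruence module of `M` into `M[𝔭] ⧸ s M[𝔭]` with cokernel `M[𝔭] ⧸ s M`. Comparing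
lengths, `δ(M) ≤ d δ(A)` holds exactly when `M[𝔭] = s M` (`wilesDefect_le_iff`); the conormal
module drops out. In that case choose `mᵢ ∈ M` such that the `s mᵢ` form a basis of `M[𝔭]`. The
map `A ^ d → M` given by the `mᵢ` is injective modulo a common regular element `x`, because the
socle of `(A ⧸ (x)) ^ d` lies in the image of `s A ^ d`. So it is injective, and `x` is regular on
its cokernel `C` (`exists_injective_of_torsion_le`). It remains to see that `C = 0`.

*The multiplicity.* In dimension one, `length (M ⧸ 𝔪ⁿM)` is eventually a linear function of `n`, so
the limit defining `e(M)` exists (`tendsto_hsMultiplicity`). If `C ≠ 0`, then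
`length (C ⧸ 𝔪ⁿC) ≥ n`, and the Artin–Rees lemma gives `e(M) ≥ d e(A) + 1`
(`add_one_le_hsMultiplicity`).

*Generic ranks.* If `M` has rank at most `d` at a minimal prime `q`, then `A_q ^ d` surjects onto
`M_q` and also embeds in it. As `A_q` is artinian, the embedding is an isomorphism, so `C_q = 0`
(`notMem_support_of_injective`). Since `x` is regular on `C`, all associated primes of `C` are
minimal primes of `A`; hence `C = 0`.
-/

noncomputable section

namespace WilesDefect

/-! ### Descent of the vanishing of Ext -/

section ExtVanishing

open CategoryTheory Abelian IsLocalRing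
open scoped Pointwise

variable {A : Type u} [CommRing A]

theorem subsingleton_ext_of_exact {N₁ N₂ N₃ : Type u} [AddCommGroup N₁] [Module A N₁]
    [AddCommGroup N₂] [Module A N₂] [AddCommGroup N₃] [Module A N₃] (f : N₁ →ₗ[A] N₂)
    (g : N₂ →ₗ[A] N₃) (hf : Function.Injective f) (hg : Function.Surjective g)
    (hfg : Function.Exact f g) (X : ModuleCat.{u} A) (n : ℕ)
    (h₁ : Subsingleton (Ext (ModuleCat.of A N₁) X n))
    (h₃ : Subsingleton (Ext (ModuleCat.of A N₃) X n)) :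
    Subsingleton (Ext (ModuleCat.of A N₂) X n) := by
  let S := ModuleCat.shortComplexOfCompEqZero f g hfg.linearMap_comp_eq_zero
  have hS : S.ShortExact := ModuleCat.shortComplex_shortExact S hfg hf hg
  refine subsingleton_of_forall_eq 0 fun e => ?_
  obtain ⟨e', rfl⟩ := Ext.contravariant_sequence_exact₂ hS X e (h₁.elim _ _)
  rw [h₃.elim e' 0, Ext.comp_zero]

theorem subsingleton_ext_of_injective {N₁ N₂ : Type u} [AddCommGroup N₁] [Module A N₁]
    [AddCommGroup N₂] [Module A N₂] (f : N₁ →ₗ[A] N₂) (hf : Function.Injective f)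
    (X : ModuleCat.{u} A) (n : ℕ) (h₂ : Subsingleton (Ext (ModuleCat.of A N₂) X n))
    (h₃ : Subsingleton (Ext (ModuleCat.of A (N₂ ⧸ LinearMap.range f)) X (n + 1))) :
    Subsingleton (Ext (ModuleCat.of A N₁) X n) := by
  let S := ModuleCat.shortComplexOfCompEqZero f (LinearMap.range f).mkQ
    f.exact_map_mkQ_range.linearMap_comp_eq_zero
  have hS : S.ShortExact := ModuleCat.shortComplex_shortExact S f.exact_map_mkQ_range hf
    (Submodule.mkQ_surjective _)
  refine subsingleton_of_forall_eq 0 fun e => ?_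
  obtain ⟨e', rfl⟩ := Ext.contravariant_sequence_exact₁ hS X e (add_comm 1 n) (h₃.elim _ _)
  rw [h₂.elim e' 0, Ext.comp_zero]

variable [IsLocalRing A] [IsNoetherianRing A]

/-- Since `Ext^{n+1}(-, X)` vanishes, an element of `𝔪` outside `q` acts surjectively on
`Ext^n(A ⧸ q, X)`, which is therefore zero by Nakayama's lemma. -/
theorem subsingleton_ext_quotient (X : ModuleCat.{u} A) [Module.Finite A X] (n : ℕ)
    (h : ∀ (N : Type u) [AddCommGroup N] [Module A N] [Module.Finite A N],
      Subsingleton (Ext (ModuleCat.of A N) X (n + 1)))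
    (q : Ideal A) [q.IsPrime] (hq : q ≠ maximalIdeal A) :
    Subsingleton (Ext (ModuleCat.of A (A ⧸ q)) X n) := by
  obtain ⟨a, ham, haq⟩ := SetLike.exists_of_lt (lt_of_le_of_ne (le_maximalIdeal_of_isPrime q) hq)
  have hreg : IsSMulRegular (ModuleCat.of A (A ⧸ q)) a := by
    refine (isSMulRegular_quotient_iff_mem_of_smul_mem (M := A) q a).2 fun b hb => ?_
    exact ((inferInstance : q.IsPrime).mem_or_mem hb).resolve_left haq
  have hS := hreg.smulShortComplex_shortExact
  have key : ∀ e : Ext (ModuleCat.of A (A ⧸ q)) X n, ∃ e', a • e' = e := by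
    intro e
    have h3 := h ((A ⧸ q) ⧸ (a • (⊤ : Submodule A (A ⧸ q))))
    obtain ⟨e', he'⟩ := Ext.contravariant_sequence_exact₁ hS X e (add_comm 1 n) (h3.elim _ _)
    change Ext (ModuleCat.of A (A ⧸ q)) X n at e'
    refine ⟨e', ?_⟩
    rw [← he']
    change _ = (Ext.mk₀ (a • 𝟙 (ModuleCat.of A (A ⧸ q)))).comp e' (zero_add n)
    rw [Ext.mk₀_smul, Ext.smul_comp, Ext.mk₀_id_comp]
  have htop : (⊤ : Submodule A (Ext (ModuleCat.of A (A ⧸ q)) X n)) = ⊥ := by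
    refine Submodule.eq_bot_of_le_smul_of_le_jacobson_bot (maximalIdeal A) _
      (Module.Finite.fg_top) (fun e _ => ?_) (maximalIdeal_le_jacobson _)
    obtain ⟨e', rfl⟩ := key e
    exact Submodule.smul_mem_smul ham trivial
  exact (Submodule.subsingleton_iff A).1 (subsingleton_of_bot_eq_top htop.symm)

/-- Let `T` be a finitely generated module containing a copy of the residue field. If
`Ext^{n+1}(-, X)` vanishes on finitely generated modules and `Ext^n(T, X) = 0`, then
`Ext^n(-, X)` vanishes on finitely generated modules: `Ext^n(k, X)` is a quotient of `Ext^n(T, X)`,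
while for a prime `q ≠ 𝔪` Nakayama's lemma gives `Ext^n(A ⧸ q, X) = 0`. -/
theorem subsingleton_ext_of_succ (X : ModuleCat.{u} A) [Module.Finite A X] (n : ℕ)
    (h : ∀ (N : Type u) [AddCommGroup N] [Module A N] [Module.Finite A N],
      Subsingleton (Ext (ModuleCat.of A N) X (n + 1)))
    (T : Type u) [AddCommGroup T] [Module A T] [Module.Finite A T]
    (hT : Subsingleton (Ext (ModuleCat.of A T) X n))
    (t : T) (ht : ∀ a : A, a • t = 0 ↔ a ∈ maximalIdeal A)
    (N : Type u) [AddCommGroup N] [Module A N] [Module.Finite A N] :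
    Subsingleton (Ext (ModuleCat.of A N) X n) := by
  have hk : Subsingleton (Ext (ModuleCat.of A (A ⧸ maximalIdeal A)) X n) := by
    have hker : maximalIdeal A = LinearMap.ker (LinearMap.toSpanSingleton A T t) := by
      ext a
      rw [LinearMap.mem_ker, LinearMap.toSpanSingleton_apply, ht]
    refine subsingleton_ext_of_injective
      ((maximalIdeal A).liftQ (LinearMap.toSpanSingleton A T t) hker.le) ?_ X n hT (h _)
    rw [← LinearMap.ker_eq_bot]
    exact Submodule.ker_liftQ_eq_bot' _ _ hker
  induction ‹Module.Finite A N› using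
    IsNoetherianRing.induction_on_isQuotientEquivQuotientPrime A with
  | subsingleton N =>
    refine subsingleton_of_forall_eq 0 fun e => ?_
    have : 𝟙 (ModuleCat.of A N) = 0 := by
      ext y
      exact Subsingleton.elim _ _
    rw [← Ext.mk₀_id_comp e, this, Ext.mk₀_zero, Ext.zero_comp]
  | quotient N q f =>
    refine subsingleton_ext_of_exact (N₃ := PUnit.{u + 1}) f.symm.toLinearMap 0 f.symm.injective
      (Function.surjective_to_subsingleton _)
      ((f.symm.toLinearMap.exact_zero_iff_surjective _).2 f.symm.surjective) X n ?_ ?_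
    · by_cases hq : q.1 = maximalIdeal A
      · rw [hq]; exact hk
      · exact subsingleton_ext_quotient X n h q.1 hq
    · refine subsingleton_of_forall_eq 0 fun e => ?_
      have : 𝟙 (ModuleCat.of A PUnit.{u + 1}) = 0 := by
        ext y
      rw [← Ext.mk₀_id_comp e, this, Ext.mk₀_zero, Ext.zero_comp]
  | exact N₁ N₂ N₃ f g hf hg hfg h₁ h₃ => exact subsingleton_ext_of_exact f g hf hg hfg X n h₁ h₃

end ExtVanishing

/-! ### Self-injective rings -/

section SelfInjective

open CategoryTheory Abelian IsLocalRing

variable {A : Type u} [CommRing A]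

theorem exact_lsmul_mkQ_span_singleton (x : A) :
    Function.Exact (LinearMap.lsmul A A x) (Submodule.mkQ (Ideal.span {x})) := by
  intro a
  rw [Submodule.mkQ_apply, Submodule.Quotient.mk_eq_zero, Ideal.mem_span_singleton']
  exact ⟨fun ⟨c, hc⟩ => ⟨c, by rw [← hc]; exact mul_comm _ _⟩,
    fun ⟨c, hc⟩ => ⟨c, by rw [← hc]; exact mul_comm _ _⟩⟩

theorem baer_of_subsingleton_ext_one
    (h : ∀ J : Ideal A, Subsingleton (Ext (ModuleCat.of A (A ⧸ J)) (ModuleCat.of A A) 1)) :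
    Module.Baer A A := by
  intro J g
  let S := ModuleCat.shortComplexOfCompEqZero J.subtype J.mkQ
    (LinearMap.exact_subtype_mkQ J).linearMap_comp_eq_zero
  have hS : S.ShortExact := ModuleCat.shortComplex_shortExact S (LinearMap.exact_subtype_mkQ J)
    J.injective_subtype J.mkQ_surjective
  obtain ⟨φ, hφ⟩ := Ext.contravariant_sequence_exact₁ hS _ (Ext.mk₀ (ModuleCat.ofHom g))
    (add_comm 1 0) ((h J).elim _ _)
  obtain ⟨φ, rfl⟩ := Ext.homEquiv₀.symm.surjective φ
  rw [Ext.homEquiv₀_symm_apply, Ext.mk₀_comp_mk₀] at hφ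
  have h2 := Ext.homEquiv₀.symm.injective hφ
  refine ⟨φ.hom, fun y hy => ?_⟩
  exact congr($(h2).hom ⟨y, hy⟩)

/-- If `Ext²(A ⧸ J, A) = 0` for all ideals `J`, then `A ⧸ (x)` is self-injective for every regular
element `x`: since `Ext¹(J, A) = 0`, an `A`-linear map `J → A ⧸ (x)` lifts to `J → A`, and after
subtraction of a multiplication the lift vanishes at `x`, hence everywhere. -/
theorem baer_quotient_of_subsingleton_ext_two
    (h : ∀ J : Ideal A, Subsingleton (Ext (ModuleCat.of A (A ⧸ J)) (ModuleCat.of A A) 2))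
    {x : A} (hx : IsSMulRegular A x) :
    Module.Baer (A ⧸ Ideal.span {x}) (A ⧸ Ideal.span {x}) := by
  intro J' g
  let J : Ideal A := J'.comap (Ideal.Quotient.mk (Ideal.span {x}))
  let l : J →ₗ[A] A ⧸ Ideal.span {x} :=
    { toFun := fun j => g ⟨Ideal.Quotient.mk _ j.1, j.2⟩
      map_add' := fun a b => by
        rw [← map_add]; rfl
      map_smul' := fun a b => by
        have : (⟨Ideal.Quotient.mk (Ideal.span {x}) (a • b : J).1, (a • b : J).2⟩ : J') =
          Ideal.Quotient.mk (Ideal.span {x}) a • (⟨Ideal.Quotient.mk _ b.1, b.2⟩ : J') := rfl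
        rw [this, map_smul]; rfl }
  have hJ : Subsingleton (Ext (ModuleCat.of A J) (ModuleCat.of A A) 1) := by
    refine subsingleton_ext_of_injective J.subtype J.injective_subtype _ 1 ?_ ?_
    · exact subsingleton_of_forall_eq 0 fun e => Ext.eq_zero_of_projective _
    · rw [Submodule.range_subtype]
      exact h J
  have hex := exact_lsmul_mkQ_span_singleton x
  let S := ModuleCat.shortComplexOfCompEqZero _ _ hex.linearMap_comp_eq_zero
  have hS : S.ShortExact := ModuleCat.shortComplex_shortExact S hex hx
    (Submodule.mkQ_surjective _)
  obtain ⟨φ, hφ⟩ := Ext.covariant_sequence_exact₃ (ModuleCat.of A J) hS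
    (Ext.mk₀ (ModuleCat.ofHom l)) (zero_add 1) (hJ.elim _ _)
  obtain ⟨φ, rfl⟩ := Ext.homEquiv₀.symm.surjective φ
  rw [Ext.homEquiv₀_symm_apply, Ext.mk₀_comp_mk₀] at hφ
  have h2 := Ext.homEquiv₀.symm.injective hφ
  have h3 : ∀ j : J, Ideal.Quotient.mk (Ideal.span {x}) (φ.hom j) =
      g ⟨Ideal.Quotient.mk _ j.1, j.2⟩ := fun j => congr($(h2).hom j)
  generalize φ.hom = f at h3
  have hxJ : x ∈ J := by
    change Ideal.Quotient.mk _ x ∈ J'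
    rw [Ideal.Quotient.eq_zero_iff_mem.2 (Ideal.mem_span_singleton_self x)]
    exact J'.zero_mem
  obtain ⟨a, ha⟩ : ∃ a, f ⟨x, hxJ⟩ = x * a := by
    have h4 := h3 ⟨x, hxJ⟩
    have h5 : (⟨Ideal.Quotient.mk (Ideal.span {x}) x, hxJ⟩ : J') = 0 :=
      Subtype.ext (Ideal.Quotient.eq_zero_iff_mem.2 (Ideal.mem_span_singleton_self x))
    have h6 : g ⟨Ideal.Quotient.mk _ x, hxJ⟩ = 0 := by rw [h5, map_zero]
    exact Ideal.mem_span_singleton.1 (Ideal.Quotient.eq_zero_iff_mem.1 (h4.trans h6))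
  have h7 : ∀ j : J, f j = j.1 * a := by
    intro j
    refine hx ?_
    change x • f j = x * (j.1 * a)
    have : x • j = j.1 • (⟨x, hxJ⟩ : J) := Subtype.ext (mul_comm _ _)
    rw [← map_smul, this, map_smul, ha, smul_eq_mul]
    ring
  refine ⟨LinearMap.toSpanSingleton _ _ (Ideal.Quotient.mk _ a), fun y hy => ?_⟩
  obtain ⟨b, rfl⟩ := Ideal.Quotient.mk_surjective y
  rw [← h3 ⟨b, hy⟩, h7, map_mul]
  rfl

/-- In a self-injective ring, `a` is a multiple of `t` as soon as it is killed by the annihilator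
of `t`. -/
theorem dvd_of_baer (h : Module.Baer A A) {t a : A} (hta : ∀ c, c * t = 0 → c * a = 0) : t ∣ a := by
  let f : A →ₗ[A] Ideal.span {t} :=
    LinearMap.toSpanSingleton A _ ⟨t, Ideal.mem_span_singleton_self t⟩
  have hf : Function.Surjective f := by
    rintro ⟨y, hy⟩
    obtain ⟨c, rfl⟩ := Ideal.mem_span_singleton'.1 hy
    exact ⟨c, rfl⟩
  have hker : LinearMap.ker f ≤ LinearMap.ker (LinearMap.toSpanSingleton A A a) := fun c hc =>
    hta c (congrArg Subtype.val (LinearMap.mem_ker.1 hc))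
  let g : Ideal.span {t} →ₗ[A] A :=
    (LinearMap.ker f).liftQ _ hker ∘ₗ (f.quotKerEquivOfSurjective hf).symm.toLinearMap
  obtain ⟨g', hg'⟩ := h _ g
  have h1 : g ⟨t, Ideal.mem_span_singleton_self t⟩ = a := by
    have : (⟨t, Ideal.mem_span_singleton_self t⟩ : Ideal.span {t}) = f 1 := by simp [f]
    rw [this]
    change (LinearMap.ker f).liftQ _ hker ((f.quotKerEquivOfSurjective hf).symm (f 1)) = a
    have h2 : (f.quotKerEquivOfSurjective hf).symm (f 1) = Submodule.Quotient.mk 1 := by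
      rw [LinearEquiv.symm_apply_eq]; rfl
    rw [h2]
    exact one_smul A a
  refine ⟨g' 1, ?_⟩
  rw [← h1, ← hg', ← smul_eq_mul, ← map_smul, smul_eq_mul, mul_one]

/-- The associated primes of a self-injective local ring are maximal: if `q = Ann b` and `y ∉ q`,
then `y b` divides `b`, so `y` is a unit. -/
theorem eq_maximalIdeal_of_baer [IsLocalRing A] (h : Module.Baer A A) {q : Ideal A}
    (hq : q.IsPrime) {b : A} (hb : ∀ c, c * b = 0 ↔ c ∈ q) : q = maximalIdeal A := by
  refine le_antisymm (le_maximalIdeal hq.ne_top) fun y hy => ?_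
  by_contra hyq
  obtain ⟨c, hc⟩ := dvd_of_baer h (t := y * b) (a := b) fun c hc => by
    rw [← mul_assoc, hb] at hc
    exact (hb c).2 ((hq.mem_or_mem hc).resolve_right hyq)
  have h1 : (1 - c * y) * b = 0 := by linear_combination hc
  have h2 : IsUnit (1 - c * y) := by
    have : c * y ∈ maximalIdeal A := Ideal.mul_mem_left _ _ hy
    by_contra h3
    have h4 := Ideal.add_mem _ ((mem_maximalIdeal _).2 h3) this
    rw [sub_add_cancel] at h4
    exact (Ideal.ne_top_iff_one _).1 (maximalIdeal.isMaximal A).ne_top h4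
  refine hq.ne_top ((Ideal.eq_top_iff_one _).2 ((hb 1).1 ?_))
  rw [h2.mul_right_eq_zero.1 h1, mul_zero]

theorem isArtinianRing_of_baer [IsLocalRing A] [IsNoetherianRing A] (h : Module.Baer A A) :
    IsArtinianRing A := by
  rw [isArtinianRing_iff_isNoetherianRing_krullDimLE_zero]
  refine ⟨inferInstance, Ring.krullDimLE_zero_iff_forall_minimalPrimes_isMaximal.2 fun q hq => ?_⟩
  have hq' : q ∈ associatedPrimes A A := by
    refine Module.associatedPrimes.minimalPrimes_annihilator_subset_associatedPrimes A A ?_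
    rwa [Module.annihilator_eq_bot.2 inferInstance]
  obtain ⟨hqp, b, rfl⟩ := isAssociatedPrime_iff.1 hq'
  rw [eq_maximalIdeal_of_baer h hqp (b := b) fun c => by
    rw [Submodule.mem_colon_singleton, Submodule.mem_bot, smul_eq_mul]]
  exact maximalIdeal.isMaximal A

end SelfInjective

/-! ### Regular elements and Gorenstein rings -/

section Regular

open CategoryTheory Abelian IsLocalRing

variable {A : Type u} [CommRing A] [IsLocalRing A]

/-- If `y ∉ N` is moved into `N` by a power of `𝔪`, then some multiple of `y` represents a nonzero
element of the socle of the quotient by `N`. -/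
theorem exists_smul_notMem_forall_smul_mem {M : Type w} [AddCommGroup M] [Module A M]
    (N : Submodule A M) {y : M} (hy : y ∉ N) (k : ℕ)
    (hk : ∀ a ∈ maximalIdeal A ^ k, a • y ∈ N) :
    ∃ b : A, b • y ∉ N ∧ ∀ a ∈ maximalIdeal A, a • b • y ∈ N := by
  induction k with
  | zero => exact absurd (by simpa using hk 1 (by simp)) hy
  | succ k ih =>
    by_cases h : ∀ a ∈ maximalIdeal A ^ k, a • y ∈ N
    · exact ih h
    · push Not at h
      obtain ⟨b, hb, hby⟩ := h
      refine ⟨b, hby, fun a ha => ?_⟩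
      rw [smul_smul]
      exact hk _ (by rw [pow_succ']; exact Ideal.mul_mem_mul ha hb)

variable [IsNoetherianRing A]

/-- A finitely generated module either has a regular element in `𝔪` or contains a copy of the
residue field, by prime avoidance. -/
theorem exists_isSMulRegular_or_exists_socle (N : Type w) [AddCommGroup N] [Module A N]
    [Module.Finite A N] :
    (∃ x ∈ maximalIdeal A, IsSMulRegular N x) ∨
      ∃ t : N, ∀ a : A, a • t = 0 ↔ a ∈ maximalIdeal A := by
  by_cases h : maximalIdeal A ∈ associatedPrimes A N
  · right
    obtain ⟨_, t, ht⟩ := isAssociatedPrime_iff.1 h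
    exact ⟨t, fun a => by rw [ht, Submodule.mem_colon_singleton, Submodule.mem_bot]⟩
  · left
    by_contra hx
    push Not at hx
    obtain ⟨q, hq, hle⟩ := (Ideal.subset_union_prime_finite (associatedPrimes.finite A N)
      (f := id) ⊥ ⊥ (fun _ hi _ _ => hi.isPrime) (I := maximalIdeal A)).1 (by
        intro x hxm
        have h1 : x ∈ {r : A | IsSMulRegular N r}ᶜ := hx x hxm
        rw [← biUnion_associatedPrimes_eq_compl_regular] at h1
        exact h1)
    refine h ?_
    rwa [(maximalIdeal.isMaximal A).eq_of_le hq.isPrime.ne_top hle]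

/-- Two modules of positive depth have a common regular element: their product has no socle. -/
theorem exists_isSMulRegular_of_two {N : Type w} [AddCommGroup N] [Module A N]
    [Module.Finite A N] {N' : Type x} [AddCommGroup N'] [Module A N'] [Module.Finite A N']
    (h : ∃ x ∈ maximalIdeal A, IsSMulRegular N x) (h' : ∃ x ∈ maximalIdeal A, IsSMulRegular N' x) :
    ∃ x ∈ maximalIdeal A, IsSMulRegular N x ∧ IsSMulRegular N' x := by
  rcases exists_isSMulRegular_or_exists_socle (A := A) (N × N') with ⟨x, hxm, hx⟩ | ⟨t, ht⟩
  · refine ⟨x, hxm, fun a b hab => ?_, fun a b hab => ?_⟩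
    · exact congrArg Prod.fst (hx (a₁ := (a, 0)) (a₂ := (b, 0)) (Prod.ext hab rfl))
    · exact congrArg Prod.snd (hx (a₁ := (0, a)) (a₂ := (0, b)) (Prod.ext rfl hab))
  · exfalso
    obtain ⟨x, hxm, hx⟩ := h
    obtain ⟨y, hym, hy⟩ := h'
    have h1 : t.1 = 0 := hx.right_eq_zero_of_smul (congrArg Prod.fst ((ht x).2 hxm))
    have h2 : t.2 = 0 := hy.right_eq_zero_of_smul (congrArg Prod.snd ((ht y).2 hym))
    have h3 : t = 0 := Prod.ext h1 h2
    exact (Ideal.ne_top_iff_one _).1 (maximalIdeal.isMaximal A).ne_top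
      ((ht 1).1 (by rw [h3, smul_zero]))

/-- A Gorenstein local ring with an associated prime `𝔭 ≠ 𝔪`, such that `A ⧸ (x)` contains a copy of
the residue field for every regular `x ∈ 𝔪`, has positive depth, and `A ⧸ (x)` is self-injective
for every regular `x`. The vanishing of `Ext^n(-, A)` descends to `n = 1` (that is, `A` is
self-injective, which is impossible as `𝔭 ≠ 𝔪`) if `A` has depth zero, and to `n = 2` otherwise. -/
theorem IsGorenstein.exists_isSMulRegular_and_baer (hG : IsGorenstein A) {p : Ideal A}
    (hp : p.IsPrime) {s : A} (hs : ∀ c, c * s = 0 ↔ c ∈ p) (hpm : p ≠ maximalIdeal A)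
    (hk : ∀ x ∈ maximalIdeal A, IsSMulRegular A x →
      ∃ t : A ⧸ Ideal.span {x}, ∀ a : A, a • t = 0 ↔ a ∈ maximalIdeal A) :
    (∃ x ∈ maximalIdeal A, IsSMulRegular A x) ∧
      ∀ x : A, IsSMulRegular A x → Module.Baer (A ⧸ Ideal.span {x}) (A ⧸ Ideal.span {x}) := by
  let P : ℕ → Prop := fun n => ∀ (N : Type u) [AddCommGroup N] [Module A N] [Module.Finite A N],
    Subsingleton (Ext (ModuleCat.of A N) (ModuleCat.of A A) n)
  obtain ⟨n, hn⟩ := (injectiveDimension_ne_top_iff _).1 hG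
  have hPn : ∀ i, n + 1 ≤ i → P i := fun i hi N _ _ _ =>
    HasInjectiveDimensionLT.subsingleton _ (n + 1) i hi _
  have descend : ∀ k, (∀ i, k ≤ i → P (i + 1) → P i) → P k := by
    intro k hk
    have h1 : ∀ j, P (k + (n + 1) - j) ∨ n + 1 < j := by
      intro j
      induction j with
      | zero => exact Or.inl (hPn _ (by omega))
      | succ j ih =>
        by_cases hj : n + 1 < j + 1
        · exact Or.inr hj
        · refine Or.inl (hk _ (by omega) ?_)
          rw [show k + (n + 1) - (j + 1) + 1 = k + (n + 1) - j by omega]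
          exact ih.resolve_right (by omega)
    have h2 := (h1 (n + 1)).resolve_right (lt_irrefl _)
    rwa [Nat.add_sub_cancel] at h2
  have hreg : ∃ x ∈ maximalIdeal A, IsSMulRegular A x := by
    rcases exists_isSMulRegular_or_exists_socle (A := A) A with h | ⟨t, ht⟩
    · exact h
    · exfalso
      have h1 : P 1 := descend 1 fun i hi hPi N _ _ _ =>
        subsingleton_ext_of_succ (ModuleCat.of A A) i hPi A (by
          obtain ⟨j, rfl⟩ := Nat.exists_eq_add_of_le' hi
          exact subsingleton_of_forall_eq 0 fun e => Ext.eq_zero_of_projective e) t ht N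
      exact hpm (eq_maximalIdeal_of_baer (baer_of_subsingleton_ext_one fun J => h1 _) hp hs)
  refine ⟨hreg, ?_⟩
  obtain ⟨x, hxm, hx⟩ := hreg
  obtain ⟨t, ht⟩ := hk x hxm hx
  have h2 : P 2 := descend 2 fun i hi hPi N _ _ _ => by
    refine subsingleton_ext_of_succ (ModuleCat.of A A) i hPi (A ⧸ Ideal.span {x}) ?_ t ht N
    obtain ⟨j, rfl⟩ := Nat.exists_eq_add_of_le' hi
    have hex := exact_lsmul_mkQ_span_singleton x
    let S := ModuleCat.shortComplexOfCompEqZero _ _ hex.linearMap_comp_eq_zero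
    have hS : S.ShortExact := ModuleCat.shortComplex_shortExact S hex hx
      (Submodule.mkQ_surjective _)
    refine subsingleton_of_forall_eq 0 fun e => ?_
    have : Projective S.X₁ := inferInstanceAs (Projective (ModuleCat.of A A))
    have : Projective S.X₂ := inferInstanceAs (Projective (ModuleCat.of A A))
    obtain ⟨e', he'⟩ := Ext.contravariant_sequence_exact₃ hS _ e
      (Ext.eq_zero_of_projective _) (n₀ := j + 1) (by omega)
    rw [← he', Ext.eq_zero_of_projective e', Ext.comp_zero]
  exact fun x hx => baer_quotient_of_subsingleton_ext_two (fun J => h2 _) hx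

end Regular

/-! ### Modules of finite length -/

section FiniteLength

open IsLocalRing

/-- A power of the maximal ideal kills a module of finite length. -/
theorem exists_pow_smul_eq_zero_of_length_ne_top {A : Type u} [CommRing A] [IsLocalRing A]
    {X : Type x} [AddCommGroup X] [Module A X] (h : Module.length A X ≠ ⊤) :
    ∃ k, ∀ a ∈ maximalIdeal A ^ k, ∀ y : X, a • y = 0 := by
  rw [Module.length_ne_top_iff, isFiniteLength_iff_isNoetherian_isArtinian] at h
  obtain ⟨_, _⟩ := h
  obtain ⟨k, hk⟩ := IsArtinian.monotone_stabilizes (R := A) (M := X)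
    ⟨fun n => OrderDual.toDual (maximalIdeal A ^ n • (⊤ : Submodule A X)),
      fun i j hij => Submodule.smul_mono_left (Ideal.pow_le_pow_right hij)⟩
  have h1 : maximalIdeal A ^ k • (⊤ : Submodule A X) =
      maximalIdeal A ^ (k + 1) • (⊤ : Submodule A X) := hk (k + 1) (Nat.le_succ k)
  have h2 : maximalIdeal A ^ k • (⊤ : Submodule A X) = ⊥ := by
    refine Submodule.eq_bot_of_le_smul_of_le_jacobson_bot (maximalIdeal A) _
      (IsNoetherian.noetherian _) ?_ (maximalIdeal_le_jacobson _)
    rw [← Submodule.mul_smul, ← pow_succ', ← h1]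
  refine ⟨k, fun a ha y => ?_⟩
  have h3 : a • y ∈ maximalIdeal A ^ k • (⊤ : Submodule A X) := Submodule.smul_mem_smul ha trivial
  rwa [h2, Submodule.mem_bot] at h3

end FiniteLength

/-! ### Self-injective quotients by an element -/

section Quotient

open IsLocalRing

variable {A : Type u} [CommRing A] [IsLocalRing A]

theorem isArtinianRing_quotient_of_baer [IsNoetherianRing A] {x : A} (hxm : x ∈ maximalIdeal A)
    (hB : Module.Baer (A ⧸ Ideal.span {x}) (A ⧸ Ideal.span {x})) :
    IsArtinianRing (A ⧸ Ideal.span {x}) := by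
  have : Nontrivial (A ⧸ Ideal.span {x}) := Ideal.Quotient.nontrivial_iff.2 fun h =>
    (maximalIdeal.isMaximal A).ne_top (top_le_iff.1 (h ▸ (Ideal.span_singleton_le_iff_mem _).2 hxm))
  have := IsLocalRing.of_surjective' (Ideal.Quotient.mk (Ideal.span {x}))
    Ideal.Quotient.mk_surjective
  exact isArtinianRing_of_baer hB

/-- If `A ⧸ (x)` is self-injective, its socle is contained in every nonzero ideal. -/
theorem mem_of_baer_quotient {x : A}
    (hB : Module.Baer (A ⧸ Ideal.span {x}) (A ⧸ Ideal.span {x})) {t a : A}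
    (ht : t ∉ Ideal.span {x}) (ha : ∀ c ∈ maximalIdeal A, c * a ∈ Ideal.span {x}) :
    ∃ b, a - b * t ∈ Ideal.span {x} := by
  have h : Ideal.Quotient.mk (Ideal.span {x}) t ∣ Ideal.Quotient.mk (Ideal.span {x}) a := by
    refine dvd_of_baer hB fun c hc => ?_
    obtain ⟨c, rfl⟩ := Ideal.Quotient.mk_surjective c
    rw [← map_mul, Ideal.Quotient.eq_zero_iff_mem] at hc ⊢
    refine ha c ?_
    by_contra hcm
    rw [mem_maximalIdeal, mem_nonunits_iff, not_not] at hcm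
    exact ht ((Ideal.unit_mul_mem_iff_mem _ hcm).1 hc)
  obtain ⟨b, hb⟩ := h
  obtain ⟨b, rfl⟩ := Ideal.Quotient.mk_surjective b
  refine ⟨b, ?_⟩
  rw [← Ideal.Quotient.eq_zero_iff_mem, map_sub, map_mul, hb, mul_comm, sub_self]

end Quotient

/-! ### Gorenstein rings with an augmentation -/

section Augmentation

open IsLocalRing

variable {O : Type v} [CommRing O] {A : Type u} [CommRing A]

theorem mem_augIdeal {lam : A →+* O} {a : A} : a ∈ augIdeal lam ↔ lam a = 0 := RingHom.mem_ker

theorem mem_annIdeal {lam : A →+* O} {a : A} :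
    a ∈ annIdeal lam ↔ ∀ b ∈ augIdeal lam, b * a = 0 := by
  rw [annIdeal, Submodule.mem_torsionBySet_iff]
  exact ⟨fun h b hb => h ⟨b, hb⟩, fun h b => h b.1 b.2⟩

theorem mem_torsion_augIdeal {lam : A →+* O} {M : Type w} [AddCommGroup M] [Module A M] {m : M} :
    m ∈ Submodule.torsionBySet A M (augIdeal lam : Set A) ↔ ∀ b ∈ augIdeal lam, b • m = 0 := by
  rw [Submodule.mem_torsionBySet_iff]
  exact ⟨fun h b hb => h ⟨b, hb⟩, fun h b => h b.1 b.2⟩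

theorem lengthO_eq_length (lam : A →+* O) (hlam : Function.Surjective lam)
    (X : Type x) [AddCommGroup X] [Module A X]
    (hX : Module.IsTorsionBySet A X (augIdeal lam : Set A)) :
    lengthO lam hlam X hX = Module.length A X := by
  let := augModule lam hlam X hX
  let : Algebra A O := lam.toAlgebra
  have : IsScalarTower A O X := by
    refine ⟨fun a b m => ?_⟩
    obtain ⟨c, rfl⟩ := hlam b
    rw [Algebra.smul_def, RingHom.algebraMap_toAlgebra, ← map_mul]
    exact (augModule_smul lam hlam X hX (a * c) m).trans
      ((mul_smul a c m).trans congr(a • $(augModule_smul lam hlam X hX c m)).symm)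
  exact (Module.length_eq_of_surjective (R := O) (S := A) (M := X) hlam).symm

variable [IsDomain O]

theorem augIdeal_isPrime (lam : A →+* O) : (augIdeal lam).IsPrime := RingHom.ker_isPrime lam

/-- A generator of the annihilator of `𝔭` is not divisible by a regular element `x` of `𝔪`, since
its quotient by `x` would again annihilate `𝔭`. -/
theorem notMem_span_of_annIdeal_eq_span [IsLocalRing A] {lam : A →+* O} {x : A}
    (hxm : x ∈ maximalIdeal A) (hx : IsSMulRegular A x) {t : A} (htp : t ∉ augIdeal lam)
    (ht : ∀ c, c * t = 0 ↔ c ∈ augIdeal lam) (hI : annIdeal lam = Ideal.span {t}) :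
    t ∉ Ideal.span {x} := by
  intro h
  obtain ⟨y, rfl⟩ := Ideal.mem_span_singleton.1 h
  have hy : y ∈ annIdeal lam := mem_annIdeal.2 fun b hb => by
    refine hx.right_eq_zero_of_smul ?_
    rw [smul_eq_mul, mul_left_comm]
    exact (ht b).2 hb
  rw [hI] at hy
  obtain ⟨c, hc⟩ := Ideal.mem_span_singleton'.1 hy
  have h1 : (1 - c * x) * (x * y) = 0 := by linear_combination -x * hc
  have h2 : (1 - c * x) ∈ augIdeal lam := (ht _).1 h1
  have h3 := Ideal.add_mem _ (le_maximalIdeal (augIdeal_isPrime lam).ne_top h2)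
    (Ideal.mul_mem_left _ c hxm)
  rw [sub_add_cancel] at h3
  exact (Ideal.ne_top_iff_one _).1 (maximalIdeal.isMaximal A).ne_top h3

variable [IsDiscreteValuationRing O] [IsLocalRing A]

theorem augIdeal_ne_maximalIdeal {lam : A →+* O} (hlam : Function.Surjective lam) :
    augIdeal lam ≠ maximalIdeal A := by
  intro h
  have h1 : (RingHom.ker lam).IsMaximal := by
    have := maximalIdeal.isMaximal A
    rwa [← h] at this
  have h2 := (Ideal.Quotient.maximal_ideal_iff_isField_quotient _).1 h1
  exact IsDiscreteValuationRing.not_isField O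
    ((RingHom.quotientKerEquivOfSurjective hlam).symm.isField h2)

/-- For `a ∉ 𝔭` the ring `A ⧸ (𝔭 + (a)) = O ⧸ (lam a)` is artinian. -/
theorem exists_pow_maximalIdeal_le {lam : A →+* O} (hlam : Function.Surjective lam) {a : A}
    (ha : a ∉ augIdeal lam) : ∃ k, maximalIdeal A ^ k ≤ augIdeal lam ⊔ Ideal.span {a} := by
  have hmap : Ideal.map lam (maximalIdeal A) ≤ maximalIdeal O := by
    have : IsLocalHom lam := IsLocalHom.of_surjective lam hlam
    exact ((local_hom_TFAE lam).out 0 2).1 this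
  obtain ⟨ϖ, hϖ⟩ := IsDiscreteValuationRing.exists_irreducible O
  obtain ⟨k, hk⟩ := IsDiscreteValuationRing.ideal_eq_span_pow_irreducible
    (s := Ideal.span {lam a}) (by simpa [Ideal.span_singleton_eq_bot, mem_augIdeal] using ha) hϖ
  refine ⟨k, fun b hb => ?_⟩
  have h1 : lam b ∈ Ideal.span {lam a} := by
    rw [hk, ← Ideal.span_singleton_pow, ← hϖ.maximalIdeal_eq]
    refine Ideal.pow_right_mono hmap k ?_
    rw [← Ideal.map_pow]
    exact Ideal.mem_map_of_mem _ hb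
  obtain ⟨c', hc⟩ := Ideal.mem_span_singleton'.1 h1
  obtain ⟨c, rfl⟩ := hlam c'
  rw [← sub_add_cancel b (c * a)]
  refine Submodule.add_mem_sup ?_ (Ideal.mul_mem_left _ _ (Ideal.mem_span_singleton_self a))
  rw [mem_augIdeal, map_sub, map_mul, hc, sub_self]

variable [IsNoetherianRing A]

/-- An element `c ∉ 𝔭` of a power of `𝔪` that kills `𝔭 ⧸ 𝔭²` maps `𝔭` into `𝔭 · 𝔭`. By the
determinant trick some monic polynomial in `c` whose lower coefficients lie in `𝔭` kills `𝔭`. -/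
theorem IsObj.exists_notMem_mul_eq_zero {lam : A →+* O} (hA : IsObj lam) :
    ∃ s ∉ augIdeal lam, ∀ a ∈ augIdeal lam, a * s = 0 := by
  have hfin := hA.conormal_finite
  rw [lengthO_eq_length] at hfin
  obtain ⟨k, hk⟩ := exists_pow_smul_eq_zero_of_length_ne_top hfin
  obtain ⟨c, hcm, hcp⟩ : ∃ c ∈ maximalIdeal A ^ k, c ∉ augIdeal lam := by
    by_contra h
    push Not at h
    have := augIdeal_isPrime lam
    refine augIdeal_ne_maximalIdeal hA.surjective ?_
    exact ((maximalIdeal.isMaximal A).eq_of_le this.ne_top (this.le_of_pow_le h)).symm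
  have hrange : LinearMap.range (Algebra.lsmul A A (augIdeal lam) c) ≤
      augIdeal lam • (⊤ : Submodule A (augIdeal lam)) := by
    rintro _ ⟨z, rfl⟩
    have h := hk c hcm ((augIdeal lam).toCotangent z)
    rw [← map_smul, Ideal.toCotangent_eq_zero, pow_two] at h
    rw [Submodule.mem_smul_top_iff]
    exact h
  obtain ⟨q, hq, -, hcoeff, hq0⟩ :=
    LinearMap.exists_monic_and_natDegree_eq_and_coeff_mem_pow_and_aeval_eq_zero A
      (Algebra.lsmul A A (augIdeal lam) c) (augIdeal lam) hrange
  rw [Polynomial.aeval_algHom_apply] at hq0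
  refine ⟨Polynomial.aeval c q, ?_, fun a ha => ?_⟩
  · have hmap : q.map lam = Polynomial.X ^ q.natDegree := by
      ext i
      rw [Polynomial.coeff_map, Polynomial.coeff_X_pow]
      split_ifs with hi
      · rw [hi, hq.coeff_natDegree, map_one]
      · rcases lt_or_gt_of_ne hi with hi | hi
        · exact mem_augIdeal.1 (Ideal.pow_le_self (by omega) (hcoeff i))
        · rw [Polynomial.coeff_eq_zero_of_natDegree_lt hi, map_zero]
    rw [mem_augIdeal, Polynomial.coe_aeval_eq_eval, ← Polynomial.eval₂_at_apply,
      ← Polynomial.eval_map, hmap, Polynomial.eval_pow, Polynomial.eval_X]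
    exact pow_ne_zero _ fun h => hcp (mem_augIdeal.2 h)
  · have h := congrArg Subtype.val (LinearMap.congr_fun hq0 ⟨a, ha⟩)
    rw [mul_comm]
    exact h

/-- If `A` has positive depth, then `𝔭 ∩ A[𝔭] = 0`, so `A[𝔭]` is isomorphic to a nonzero ideal
of the principal ideal domain `O`. -/
theorem IsObj.exists_annIdeal_eq_span {lam : A →+* O} (hA : IsObj lam)
    {x : A} (hxm : x ∈ maximalIdeal A) (hx : IsSMulRegular A x) :
    ∃ s, s ∉ augIdeal lam ∧ (∀ c, c * s = 0 ↔ c ∈ augIdeal lam) ∧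
      annIdeal lam = Ideal.span {s} := by
  obtain ⟨s, hs, hsp⟩ := hA.exists_notMem_mul_eq_zero
  have hprime := augIdeal_isPrime lam
  obtain ⟨k, hk⟩ := exists_pow_maximalIdeal_le hA.surjective hs
  have hinf : ∀ z ∈ augIdeal lam, z ∈ annIdeal lam → z = 0 := by
    intro z hzp hzI
    refine (hx.pow k).right_eq_zero_of_smul ?_
    obtain ⟨y, hy, t, ht, hyt⟩ := Submodule.mem_sup.1 (hk (Ideal.pow_mem_pow hxm k))
    obtain ⟨c, rfl⟩ := Ideal.mem_span_singleton'.1 ht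
    rw [smul_eq_mul, ← hyt, add_mul, mem_annIdeal.1 hzI y hy, mul_assoc, mul_comm s z, hsp z hzp]
    simp
  -- Lift a generator of the image of `A[𝔭]` in `O`.
  obtain ⟨g, hg⟩ := (IsPrincipalIdealRing.principal (Ideal.map lam (annIdeal lam))).principal
  have hgmem : g ∈ Ideal.map lam (annIdeal lam) := by
    rw [hg]; exact Submodule.mem_span_singleton_self g
  obtain ⟨s₀, hs₀, rfl⟩ := (Ideal.mem_map_iff_of_surjective lam hA.surjective).1 hgmem
  have hs₀p : s₀ ∉ augIdeal lam := by
    intro h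
    have h1 : lam s ∈ Ideal.map lam (annIdeal lam) :=
      Ideal.mem_map_of_mem _ (mem_annIdeal.2 hsp)
    rw [hg, mem_augIdeal.1 h, Submodule.span_zero_singleton] at h1
    exact hs (mem_augIdeal.2 h1)
  refine ⟨s₀, hs₀p, fun c => ⟨fun h => ?_, fun h => mem_annIdeal.1 hs₀ c h⟩, le_antisymm ?_ ?_⟩
  · exact (hprime.mem_or_mem (h ▸ (augIdeal lam).zero_mem)).resolve_right hs₀p
  · intro i hi
    have h1 : lam i ∈ Ideal.map lam (annIdeal lam) := Ideal.mem_map_of_mem _ hi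
    rw [hg] at h1
    obtain ⟨c', hc⟩ := Submodule.mem_span_singleton.1 h1
    obtain ⟨c, rfl⟩ := hA.surjective c'
    refine Ideal.mem_span_singleton'.2 ⟨c, ?_⟩
    refine (sub_eq_zero.1 (hinf _ ?_ (sub_mem hi (Ideal.mul_mem_left _ c hs₀)))).symm
    rw [mem_augIdeal, map_sub, map_mul, sub_eq_zero]
    exact hc.symm
  · rw [Ideal.span_singleton_le_iff_mem]
    exact hs₀

/-- A Gorenstein ring `A` in `C_O` has positive depth, and `A ⧸ (x)` is self-injective for every
regular `x`. -/
theorem IsObj.exists_isSMulRegular_and_baer {lam : A →+* O} (hA : IsObj lam)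
    (hG : IsGorenstein A) :
    (∃ x ∈ maximalIdeal A, IsSMulRegular A x) ∧
      ∀ x : A, IsSMulRegular A x → Module.Baer (A ⧸ Ideal.span {x}) (A ⧸ Ideal.span {x}) := by
  have hprime := augIdeal_isPrime lam
  obtain ⟨s, hs, hsp⟩ := hA.exists_notMem_mul_eq_zero
  refine hG.exists_isSMulRegular_and_baer hprime (s := s) (fun c => ⟨fun h => ?_, hsp c⟩)
    (augIdeal_ne_maximalIdeal hA.surjective) fun x hxm hx => ?_
  · exact (hprime.mem_or_mem (h ▸ (augIdeal lam).zero_mem)).resolve_right hs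
  · obtain ⟨t, htp, ht, hI⟩ := hA.exists_annIdeal_eq_span hxm hx
    have ht0 : t ≠ 0 := fun h => htp (h ▸ (augIdeal lam).zero_mem)
    -- Modulo `x` the element `t` is killed by `𝔭 + (x)`, hence by a power of `𝔪`; so some multiple
    -- of it is a nonzero socle element.
    have htx := notMem_span_of_annIdeal_eq_span hxm hx htp ht hI
    have hxp : x ∉ augIdeal lam := fun h =>
      ht0 (hx.right_eq_zero_of_smul ((ht x).2 h))
    obtain ⟨k, hk⟩ := exists_pow_maximalIdeal_le hA.surjective hxp
    obtain ⟨b, hb, hbm⟩ := exists_smul_notMem_forall_smul_mem (Ideal.span {x}) htx k fun a ha => by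
      obtain ⟨y, hy, z, hz, rfl⟩ := Submodule.mem_sup.1 (hk ha)
      rw [smul_eq_mul, add_mul, (ht y).2 hy, zero_add]
      exact Ideal.mul_mem_right _ _ hz
    refine ⟨Ideal.Quotient.mk _ (b • t), fun a => ?_⟩
    have h1 : a • Ideal.Quotient.mk (Ideal.span {x}) (b • t) =
      Ideal.Quotient.mk (Ideal.span {x}) (a • b • t) := rfl
    rw [h1, Ideal.Quotient.eq_zero_iff_mem]
    refine ⟨fun h => ?_, hbm a⟩
    by_contra ha
    rw [mem_maximalIdeal, mem_nonunits_iff, not_not] at ha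
    exact hb ((Ideal.unit_mul_mem_iff_mem _ ha).1 h)

/-- A Gorenstein ring in `C_O` has dimension one. -/
theorem IsObj.dimNat_eq_one {lam : A →+* O} (hA : IsObj lam) (hG : IsGorenstein A) :
    dimNat A = 1 := by
  obtain ⟨⟨x, hxm, hx⟩, hB⟩ := hA.exists_isSMulRegular_and_baer hG
  have := isArtinianRing_quotient_of_baer hxm (hB x hx)
  have h1 := ringKrullDim_quotient_span_singleton_succ_eq_ringKrullDim hx hxm
  have : Nontrivial (A ⧸ Ideal.span {x}) := Ideal.Quotient.nontrivial_iff.2 fun h =>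
    (maximalIdeal.isMaximal A).ne_top (top_le_iff.1 (h ▸ (Ideal.span_singleton_le_iff_mem _).2 hxm))
  rw [ringKrullDimZero_iff_ringKrullDim_eq_zero.1
    (isArtinianRing_iff_isNoetherianRing_krullDimLE_zero.1 ‹_›).2, zero_add] at h1
  rw [dimNat, ← h1]
  rfl

end Augmentation

/-! ### Finite length from annihilation by a power of the maximal ideal -/

section FiniteLength

open IsLocalRing

variable {A : Type u} [CommRing A] [IsLocalRing A] [IsNoetherianRing A]

theorem length_ne_top_of_pow_smul_eq_zero {X : Type x} [AddCommGroup X] [Module A X]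
    [Module.Finite A X] {k : ℕ} (hk : ∀ a ∈ maximalIdeal A ^ k, ∀ y : X, a • y = 0) :
    Module.length A X ≠ ⊤ := by
  by_cases hX : Subsingleton X
  · rw [Module.length_eq_zero]; exact ENat.zero_ne_top
  have hk1 : maximalIdeal A ^ k ≠ ⊤ := fun h => hX <| by
    refine subsingleton_of_forall_eq 0 fun y => ?_
    rw [← one_smul A y]
    exact hk 1 (h ▸ trivial) y
  let B := A ⧸ maximalIdeal A ^ k
  have hB : IsArtinianRing B := by
    have : Nontrivial B := Ideal.Quotient.nontrivial_iff.2 hk1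
    have := IsLocalRing.of_surjective' (Ideal.Quotient.mk (maximalIdeal A ^ k))
      Ideal.Quotient.mk_surjective
    rw [isArtinianRing_iff_isNilpotent_maximalIdeal]
    refine ⟨k, ?_⟩
    have h1 : maximalIdeal B ≤ (maximalIdeal A).map (Ideal.Quotient.mk (maximalIdeal A ^ k)) := by
      intro b hb
      obtain ⟨a, rfl⟩ := Ideal.Quotient.mk_surjective b
      refine Ideal.mem_map_of_mem _ ?_
      rw [mem_maximalIdeal, mem_nonunits_iff] at hb ⊢
      exact fun h => hb (h.map _)
    rw [Ideal.zero_eq_bot, ← le_bot_iff]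
    refine (Ideal.pow_right_mono h1 k).trans ?_
    rw [← Ideal.map_pow, Ideal.map_quotient_self]
  let : Module B X := Module.IsTorsionBySet.module (I := maximalIdeal A ^ k) fun y a => hk a.1 a.2 y
  have : IsScalarTower A B X := Module.IsTorsionBySet.isScalarTower _
  have : Module.Finite B X := Module.Finite.of_restrictScalars_finite A B X
  rw [Module.length_eq_of_surjective (R := B) (S := A) (M := X) Ideal.Quotient.mk_surjective]
  exact Module.length_ne_top

end FiniteLength

/-! ### The rank of the torsion submodule -/

section TorsionRank

open IsLocalRing

variable {O : Type v} [CommRing O] {A : Type u} [CommRing A]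
variable {M : Type w} [AddCommGroup M] [Module A M]

theorem torsionRank_eq_card [Nontrivial O] {lam : A →+* O} (hA : IsObj lam) {ι : Type*} [Fintype ι]
    (e : Submodule.torsionBySet A M (augIdeal lam : Set A) ≃ₗ[A] (ι → A ⧸ augIdeal lam)) :
    torsionRank hA M = Fintype.card ι := by
  let σ : (A ⧸ augIdeal lam) ≃+* O := RingHom.quotientKerEquivOfSurjective hA.surjective
  let := augModule lam hA.surjective (Submodule.torsionBySet A M (augIdeal lam : Set A))
    (isTorsion_torsion lam M)
  have hsmul : ∀ (a : A) (m : Submodule.torsionBySet A M (augIdeal lam : Set A)),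
      lam a • m = a • m := augModule_smul lam hA.surjective _ (isTorsion_torsion lam M)
  let e' : Submodule.torsionBySet A M (augIdeal lam : Set A) ≃ₗ[O] (ι → O) :=
    { e.toAddEquiv.trans (AddEquiv.piCongrRight fun _ => σ.toAddEquiv) with
      map_smul' := fun r m => by
        obtain ⟨a, rfl⟩ := hA.surjective r
        ext i
        change σ (e (lam a • m) i) = lam a * σ (e m i)
        rw [hsmul, map_smul, Pi.smul_apply, Algebra.smul_def, map_mul]
        rfl }
  exact (Module.finrank_eq_card_basis (Module.Basis.ofEquivFun e')).trans rfl

variable [IsDomain O] [IsDiscreteValuationRing O] [IsLocalRing A]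

theorem eq_zero_of_smul_eq_zero_of_notMem {lam : A →+* O} (hlam : Function.Surjective lam)
    {x : A} (hxm : x ∈ maximalIdeal A) (hx : IsSMulRegular M x) {a : A} (ha : a ∉ augIdeal lam)
    {m : M} (hm : ∀ b ∈ augIdeal lam, b • m = 0) (ham : a • m = 0) : m = 0 := by
  obtain ⟨k, hk⟩ := exists_pow_maximalIdeal_le hlam ha
  refine (hx.pow k).right_eq_zero_of_smul ?_
  obtain ⟨y, hy, t, ht, hyt⟩ := Submodule.mem_sup.1 (hk (Ideal.pow_mem_pow hxm k))
  obtain ⟨c, rfl⟩ := Ideal.mem_span_singleton'.1 ht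
  rw [← hyt, add_smul, hm y hy, mul_smul, ham, smul_zero, add_zero]

/-- If some element of `𝔪` is regular on `M`, then `M[𝔭]` is torsion-free over the discrete
valuation ring `A ⧸ 𝔭 = O`, hence free. -/
theorem nonempty_torsion_equiv [IsNoetherianRing A] {lam : A →+* O} (hA : IsObj lam)
    [Module.Finite A M] {x : A} (hxm : x ∈ maximalIdeal A) (hx : IsSMulRegular M x) :
    Nonempty (Submodule.torsionBySet A M (augIdeal lam : Set A) ≃ₗ[A]
      (Fin (torsionRank hA M) → A ⧸ augIdeal lam)) := by
  let σ : (A ⧸ augIdeal lam) ≃+* O := RingHom.quotientKerEquivOfSurjective hA.surjective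
  let := augModule lam hA.surjective (Submodule.torsionBySet A M (augIdeal lam : Set A))
    (isTorsion_torsion lam M)
  have hsmul : ∀ (a : A) (m : Submodule.torsionBySet A M (augIdeal lam : Set A)),
      lam a • m = a • m := augModule_smul lam hA.surjective _ (isTorsion_torsion lam M)
  have hfin : Module.Finite O (Submodule.torsionBySet A M (augIdeal lam : Set A)) := by
    obtain ⟨S, hS⟩ := IsNoetherian.noetherian
      (⊤ : Submodule A (Submodule.torsionBySet A M (augIdeal lam : Set A)))
    refine ⟨S, top_le_iff.1 fun m _ => ?_⟩
    have hm : m ∈ Submodule.span A (S : Set (Submodule.torsionBySet A M (augIdeal lam : Set A))) :=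
      hS ▸ trivial
    induction hm using Submodule.span_induction with
    | mem y hy => exact Submodule.subset_span hy
    | zero => exact zero_mem _
    | add y z _ _ hy hz => exact add_mem (hy trivial) (hz trivial)
    | smul a y _ hy => rw [← hsmul]; exact Submodule.smul_mem _ _ (hy trivial)
  have htf : Module.IsTorsionFree O (Submodule.torsionBySet A M (augIdeal lam : Set A)) := by
    rw [Module.isTorsionFree_iff_smul_eq_zero]
    intro r m hrm
    obtain ⟨a, rfl⟩ := hA.surjective r
    rw [hsmul] at hrm
    by_cases ha : a ∈ augIdeal lam
    · exact Or.inl (mem_augIdeal.1 ha)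
    · exact Or.inr (Subtype.ext (eq_zero_of_smul_eq_zero_of_notMem hA.surjective hxm hx ha
        (mem_torsion_augIdeal.1 m.2) (congrArg Subtype.val hrm)))
  have hfree : Module.Free O (Submodule.torsionBySet A M (augIdeal lam : Set A)) :=
    Module.free_of_finite_type_torsion_free'
  let b := (Module.finBasis O (Submodule.torsionBySet A M (augIdeal lam : Set A))).equivFun
  exact ⟨{ b.toAddEquiv.trans (AddEquiv.piCongrRight fun _ => σ.symm.toAddEquiv) with
      map_smul' := fun a m => by
        ext i
        change σ.symm (b (a • m) i) = a • σ.symm (b m i)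
        rw [← hsmul, map_smul, Pi.smul_apply, smul_eq_mul, map_mul, Algebra.smul_def]
        congr 1
        rw [RingEquiv.symm_apply_eq]
        rfl }⟩

end TorsionRank

/-! ### The congruence module and the Wiles defect -/

section Congruence

open IsLocalRing

variable {O : Type v} [CommRing O] {A : Type u} [CommRing A] {lam : A →+* O}
variable {M : Type w} [AddCommGroup M] [Module A M]

/-- Let `A[𝔭] = (s)` and let `M[𝔭]` be free of rank `#ι` over `A ⧸ 𝔭`. Multiplication by `s` embeds
the congruence module of `M` into `M[𝔭] ⧸ s M[𝔭]`, with cokernel `M[𝔭] ⧸ s M`. -/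
theorem length_congruenceModule_add {s : A} (hsp : ∀ c ∈ augIdeal lam, c * s = 0)
    (hI : annIdeal lam = Ideal.span {s}) {ι : Type*} [Fintype ι]
    (e : Submodule.torsionBySet A M (augIdeal lam : Set A) ≃ₗ[A] (ι → A ⧸ augIdeal lam)) :
    Module.length A (CongruenceModule lam M) +
      Module.length A (Submodule.torsionBySet A M (augIdeal lam : Set A) ⧸
        (LinearMap.range (LinearMap.lsmul A M s)).comap
          (Submodule.torsionBySet A M (augIdeal lam : Set A)).subtype) =
      Fintype.card ι * Module.length A (A ⧸ (augIdeal lam ⊔ Ideal.span {s})) := by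
  set L := Submodule.torsionBySet A M (augIdeal lam : Set A) with hL
  let T₁ : Submodule A L := LinearMap.range (LinearMap.lsmul A L s)
  let T₂ : Submodule A L := (LinearMap.range (LinearMap.lsmul A M s)).comap L.subtype
  have hsM : ∀ m : M, s • m ∈ L := fun m => mem_torsion_augIdeal.2 fun b hb => by
    rw [smul_smul, hsp b hb, zero_smul]
  have hle : T₁ ≤ T₂ := by
    rintro _ ⟨l, rfl⟩
    exact ⟨l.1, rfl⟩
  have hI' : ∀ m : M, m ∈ Submodule.torsionBySet A M (annIdeal lam : Set A) ↔ s • m = 0 := by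
    intro m
    rw [hI, Submodule.mem_torsionBySet_iff]
    refine ⟨fun h => h ⟨s, Ideal.mem_span_singleton_self s⟩, fun h => ?_⟩
    rintro ⟨b, hb⟩
    obtain ⟨c, rfl⟩ := Ideal.mem_span_singleton'.1 hb
    change (c * s) • m = 0
    rw [mul_smul, h, smul_zero]
  -- `L / sL` is `(A / (𝔭 + s))^ι`.
  have h1 : Module.length A (L ⧸ T₁) =
      Fintype.card ι * Module.length A (A ⧸ (augIdeal lam ⊔ Ideal.span {s})) := by
    let π : A ⧸ augIdeal lam →ₗ[A] A ⧸ (augIdeal lam ⊔ Ideal.span {s}) :=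
      Submodule.factor le_sup_left
    let φ : L →ₗ[A] (ι → A ⧸ (augIdeal lam ⊔ Ideal.span {s})) :=
      LinearMap.pi (fun i => π ∘ₗ LinearMap.proj i) ∘ₗ e.toLinearMap
    have hφ : Function.Surjective φ := by
      intro y
      choose a ha using fun i => Ideal.Quotient.mk_surjective (y i)
      refine ⟨e.symm fun i => Ideal.Quotient.mk _ (a i), ?_⟩
      ext i
      change π (e (e.symm _) i) = y i
      rw [LinearEquiv.apply_symm_apply, ← ha i]
      rfl
    have hker : LinearMap.ker φ = T₁ := by
      ext l
      rw [LinearMap.mem_ker]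
      constructor
      · intro h
        choose a ha using fun i => Ideal.Quotient.mk_surjective (e l i)
        have h2 : ∀ i, ∃ c, Ideal.Quotient.mk (augIdeal lam) (a i) =
            s • Ideal.Quotient.mk (augIdeal lam) c := by
          intro i
          have h3 : π (e l i) = 0 := congrFun h i
          rw [← ha i] at h3
          have h4 : a i ∈ augIdeal lam ⊔ Ideal.span {s} := Ideal.Quotient.eq_zero_iff_mem.1 h3
          obtain ⟨y, hy, t, ht, hyt⟩ := Submodule.mem_sup.1 h4
          obtain ⟨c, rfl⟩ := Ideal.mem_span_singleton'.1 ht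
          refine ⟨c, ?_⟩
          rw [← hyt, map_add, Ideal.Quotient.eq_zero_iff_mem.2 hy, zero_add, mul_comm, map_mul]
          rfl
        choose c hc using h2
        refine ⟨e.symm fun i => Ideal.Quotient.mk _ (c i), ?_⟩
        apply e.injective
        ext i
        rw [LinearMap.lsmul_apply, map_smul, LinearEquiv.apply_symm_apply, Pi.smul_apply, ← hc,
          ha]
      · rintro ⟨l', rfl⟩
        ext i
        change π (e (s • l') i) = 0
        rw [map_smul, Pi.smul_apply, map_smul]
        obtain ⟨c, hc⟩ := Submodule.Quotient.mk_surjective _ (π (e l' i))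
        rw [← hc, ← Submodule.Quotient.mk_smul, Submodule.Quotient.mk_eq_zero]
        exact Submodule.mem_sup_right (Ideal.mul_mem_right _ _ (Ideal.mem_span_singleton_self s))
    rw [← hker, (φ.quotKerEquivOfSurjective hφ).length_eq, Module.length_pi_of_fintype]
    simp
  let α : M →ₗ[A] L ⧸ T₁ := T₁.mkQ ∘ₗ (LinearMap.lsmul A M s).codRestrict L hsM
  have hα : LinearMap.ker α = L ⊔ Submodule.torsionBySet A M (annIdeal lam : Set A) := by
    ext m
    rw [LinearMap.mem_ker]
    change Submodule.Quotient.mk (p := T₁) ⟨s • m, hsM m⟩ = 0 ↔ _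
    rw [Submodule.Quotient.mk_eq_zero, Submodule.mem_sup]
    constructor
    · rintro ⟨l, hl⟩
      refine ⟨l.1, l.2, m - l.1, ?_, add_sub_cancel _ _⟩
      rw [hI', smul_sub, sub_eq_zero]
      exact (congrArg Subtype.val hl).symm
    · rintro ⟨l, hl, z, hz, rfl⟩
      refine ⟨⟨l, hl⟩, Subtype.ext ?_⟩
      change s • l = s • (l + z)
      rw [smul_add, (hI' z).1 hz, add_zero]
  have hinj : Function.Injective ((L ⊔ Submodule.torsionBySet A M (annIdeal lam : Set A)).liftQ α
      hα.ge) := by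
    rw [← LinearMap.ker_eq_bot]
    exact Submodule.ker_liftQ_eq_bot' _ _ hα.symm
  have hex : Function.Exact ((L ⊔ Submodule.torsionBySet A M (annIdeal lam : Set A)).liftQ α
      hα.ge) (Submodule.factor hle) := by
    intro y
    obtain ⟨l, rfl⟩ := Submodule.Quotient.mk_surjective _ y
    change Submodule.Quotient.mk (p := T₂) l = 0 ↔ _
    rw [Submodule.Quotient.mk_eq_zero]
    constructor
    · rintro ⟨m, hm⟩
      refine ⟨Submodule.Quotient.mk m, ?_⟩
      change Submodule.Quotient.mk (p := T₁) ⟨s • m, hsM m⟩ = _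
      congr 1
      exact Subtype.ext hm
    · rintro ⟨m, hm⟩
      obtain ⟨m, rfl⟩ := Submodule.Quotient.mk_surjective _ m
      change Submodule.Quotient.mk (p := T₁) ⟨s • m, hsM m⟩ = _ at hm
      rw [Submodule.Quotient.eq] at hm
      obtain ⟨l', hl'⟩ := hm
      refine ⟨m - l'.1, ?_⟩
      have h3 : s • l'.1 = s • m - l.1 := congrArg Subtype.val hl'
      change s • (m - l'.1) = l.1
      rw [smul_sub, h3, sub_sub_cancel]
  rw [← h1]
  exact (Module.length_eq_add_of_exact _ _ hinj (Submodule.factor_surjective hle) hex).symm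

theorem nonempty_torsion_self_equiv {s : A} (hs : ∀ c, c * s = 0 ↔ c ∈ augIdeal lam)
    (hI : annIdeal lam = Ideal.span {s}) :
    Nonempty (Submodule.torsionBySet A A (augIdeal lam : Set A) ≃ₗ[A]
      (Unit → A ⧸ augIdeal lam)) := by
  change Nonempty (annIdeal lam ≃ₗ[A] (Unit → A ⧸ augIdeal lam))
  rw [hI]
  let f : A →ₗ[A] Ideal.span {s} :=
    LinearMap.toSpanSingleton A _ ⟨s, Ideal.mem_span_singleton_self s⟩
  have hf : Function.Surjective f := by
    rintro ⟨y, hy⟩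
    obtain ⟨c, rfl⟩ := Ideal.mem_span_singleton'.1 hy
    exact ⟨c, rfl⟩
  have hker : LinearMap.ker f = augIdeal lam := by
    ext c
    rw [LinearMap.mem_ker, ← hs]
    exact ⟨fun h => congrArg Subtype.val h, fun h => Subtype.ext h⟩
  exact ⟨(f.quotKerEquivOfSurjective hf).symm ≪≫ₗ Submodule.quotEquivOfEq _ _ hker ≪≫ₗ
    (LinearEquiv.funUnique Unit A _).symm⟩

variable [IsDomain O] [IsDiscreteValuationRing O] [IsLocalRing A] [IsNoetherianRing A]

theorem length_quotient_augIdeal_sup_ne_top (hlam : Function.Surjective lam) {s : A}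
    (hs : s ∉ augIdeal lam) : Module.length A (A ⧸ (augIdeal lam ⊔ Ideal.span {s})) ≠ ⊤ := by
  obtain ⟨k, hk⟩ := exists_pow_maximalIdeal_le hlam hs
  refine length_ne_top_of_pow_smul_eq_zero (k := k) fun a ha y => ?_
  obtain ⟨b, rfl⟩ := Submodule.Quotient.mk_surjective _ y
  rw [← Submodule.Quotient.mk_smul, Submodule.Quotient.mk_eq_zero]
  exact Ideal.mul_mem_right _ _ (hk ha)

/-- The number `r` is the length of `M[𝔭] ⧸ s M`. -/
theorem length_congruenceModule_toNat_add (hA : IsObj lam) {s : A} (hs : s ∉ augIdeal lam)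
    (hsp : ∀ c ∈ augIdeal lam, c * s = 0)
    (hI : annIdeal lam = Ideal.span {s}) {ι : Type*} [Fintype ι]
    (e : Submodule.torsionBySet A M (augIdeal lam : Set A) ≃ₗ[A] (ι → A ⧸ augIdeal lam)) :
    ∃ r : ℕ, (lengthO lam hA.surjective (CongruenceModule lam M) (isTorsion_congruence lam M)).toNat
      + r = Fintype.card ι * (Module.length A (A ⧸ (augIdeal lam ⊔ Ideal.span {s}))).toNat ∧
      (r = 0 ↔ Submodule.torsionBySet A M (augIdeal lam : Set A) ≤
        LinearMap.range (LinearMap.lsmul A M s)) := by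
  have h := length_congruenceModule_add hsp hI e
  have hη := length_quotient_augIdeal_sup_ne_top hA.surjective hs
  rw [lengthO_eq_length]
  have hfin : (Fintype.card ι : ℕ∞) * Module.length A (A ⧸ (augIdeal lam ⊔ Ideal.span {s})) ≠ ⊤ :=
    WithTop.mul_ne_top (ENat.natCast_ne_top _) hη
  rw [← h, Ne, ENat.add_eq_top, not_or] at hfin
  refine ⟨_, (ENat.toNat_add hfin.1 hfin.2).symm.trans ?_, ?_⟩
  · rw [h, ENat.toNat_mul, ENat.toNat_natCast]
  · rw [ENat.toNat_eq_zero, or_iff_left hfin.2, Module.length_eq_zero_iff,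
      Submodule.Quotient.subsingleton_iff, Submodule.comap_subtype_eq_top]

/-- The inequality of Wiles defects says that `M[𝔭]` is as small as possible, namely `s M`, where
`A[𝔭] = (s)`. -/
theorem wilesDefect_le_iff (hA : IsObj lam) [Module.Finite A M]
    {x : A} (hxm : x ∈ maximalIdeal A) (hx : IsSMulRegular M x) {s : A} (hsp : s ∉ augIdeal lam)
    (hs : ∀ c, c * s = 0 ↔ c ∈ augIdeal lam) (hI : annIdeal lam = Ideal.span {s}) :
    wilesDefect hA M ≤ (torsionRank hA M : ℤ) * wilesDefect hA A ↔
      Submodule.torsionBySet A M (augIdeal lam : Set A) ≤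
        LinearMap.range (LinearMap.lsmul A M s) := by
  obtain ⟨e⟩ := nonempty_torsion_equiv hA hxm hx
  obtain ⟨e'⟩ := nonempty_torsion_self_equiv hs hI
  obtain ⟨r, hr, hr0⟩ := length_congruenceModule_toNat_add hA hsp (fun c => (hs c).2) hI e
  obtain ⟨r', hr', hr0'⟩ := length_congruenceModule_toNat_add hA hsp (fun c => (hs c).2) hI e'
  have h0 : r' = 0 := hr0'.2 fun y hy => by
    change y ∈ annIdeal lam at hy
    rw [hI] at hy
    obtain ⟨c, rfl⟩ := Ideal.mem_span_singleton'.1 hy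
    exact ⟨c, mul_comm s c⟩
  rw [← hr0, wilesDefect, wilesDefect, torsionRank_eq_card hA e']
  rw [Fintype.card_fin] at hr
  rw [h0, add_zero] at hr'
  rw [hr']
  have hr2 := congrArg (Nat.cast (R := ℤ)) hr
  push_cast at hr2 ⊢
  rw [Fintype.card_unit]
  push_cast
  constructor
  · intro h
    have : (r : ℤ) ≤ 0 := by linarith
    omega
  · intro h
    rw [h] at hr2
    push_cast at hr2
    linarith

end Congruence

/-! ### Embedding a free module -/

section Embedding

open IsLocalRing

variable {A : Type u} [CommRing A] [IsLocalRing A] [IsNoetherianRing A]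

theorem exists_pow_maximalIdeal_le_span {x : A} (hxm : x ∈ maximalIdeal A)
    (hB : Module.Baer (A ⧸ Ideal.span {x}) (A ⧸ Ideal.span {x})) :
    ∃ k, maximalIdeal A ^ k ≤ Ideal.span {x} := by
  have := isArtinianRing_quotient_of_baer hxm hB
  have h : Module.length A (A ⧸ Ideal.span {x}) ≠ ⊤ := by
    rw [Module.length_eq_of_surjective (R := A ⧸ Ideal.span {x}) (S := A)
      (M := A ⧸ Ideal.span {x}) Ideal.Quotient.mk_surjective]
    exact Module.length_ne_top
  obtain ⟨k, hk⟩ := exists_pow_smul_eq_zero_of_length_ne_top h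
  refine ⟨k, fun a ha => ?_⟩
  rw [← Ideal.Quotient.eq_zero_iff_mem, ← mul_one a, map_mul, map_one]
  exact hk a ha 1

variable {O : Type v} [CommRing O] [IsDomain O] {lam : A →+* O}
variable {M : Type w} [AddCommGroup M] [Module A M]

/-- Suppose that `A ⧸ (x)` is self-injective, that `A[𝔭] = (s)` and that `M[𝔭] = s M` is free over
`A ⧸ 𝔭`. Elements `mᵢ` such that the `s mᵢ` form a basis of `M[𝔭]` define a map `A^ι → M` that is
injective with `x` regular on its cokernel. Modulo `x` the map is injective on
`s A^ι`, which contains the socle of `(A ⧸ (x))^ι`; so it is injective modulo `x`. -/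
theorem exists_injective_of_torsion_le {x s : A} (hxm : x ∈ maximalIdeal A)
    (hxA : IsSMulRegular A x) (hxM : IsSMulRegular M x)
    (hB : Module.Baer (A ⧸ Ideal.span {x}) (A ⧸ Ideal.span {x}))
    (hsp : s ∉ augIdeal lam) (hs : ∀ c, c * s = 0 ↔ c ∈ augIdeal lam)
    (hI : annIdeal lam = Ideal.span {s}) {ι : Type*} [Finite ι]
    (e : Submodule.torsionBySet A M (augIdeal lam : Set A) ≃ₗ[A] (ι → A ⧸ augIdeal lam))
    (hle : Submodule.torsionBySet A M (augIdeal lam : Set A) ≤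
      LinearMap.range (LinearMap.lsmul A M s)) :
    ∃ f : (ι → A) →ₗ[A] M, Function.Injective f ∧ IsSMulRegular (M ⧸ LinearMap.range f) x := by
  classical
  have := Fintype.ofFinite ι
  set L := Submodule.torsionBySet A M (augIdeal lam : Set A) with hL
  choose m hm using fun i => hle (e.symm (Pi.single i (Ideal.Quotient.mk _ 1))).2
  let f : (ι → A) →ₗ[A] M := Fintype.linearCombination A m
  have hf : ∀ a : ι → A, s • f a = (e.symm fun i => Ideal.Quotient.mk _ (a i) : L) := by
    intro a
    have h1 : (fun i => Ideal.Quotient.mk (augIdeal lam) (a i)) =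
        ∑ i, a i • Pi.single i (Ideal.Quotient.mk (augIdeal lam) 1) := by
      ext j
      rw [Finset.sum_apply, Finset.sum_eq_single j]
      · rw [Pi.smul_apply, Pi.single_eq_same, map_one, Algebra.smul_def, mul_one]
        rfl
      · intro b _ hb
        rw [Pi.smul_apply, Pi.single_eq_of_ne hb.symm, smul_zero]
      · exact fun h => absurd (Finset.mem_univ j) h
    rw [h1, map_sum, Fintype.linearCombination_apply, Finset.smul_sum, Submodule.coe_sum]
    refine Finset.sum_congr rfl fun i _ => ?_
    rw [map_smul, Submodule.coe_smul, ← hm, smul_comm]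
    rfl
  have hsx := notMem_span_of_annIdeal_eq_span hxm hxA hsp hs hI
  obtain ⟨k, hk⟩ := exists_pow_maximalIdeal_le_span hxm hB
  -- `f` is injective modulo `x`: otherwise some `b • a` represents a nonzero socle element in the
  -- kernel, so `b • a = s • c + x • r`; then `s • f c` is `x` times an element of `M[𝔭]`, and
  -- comparing coordinates in `M[𝔭]` shows that `s • c`, hence `b • a`, is divisible by `x`.
  have key : ∀ a, (∃ y, f a = x • y) → ∃ a', a = x • a' := by
    rintro a ⟨y, hy⟩
    by_contra hcon
    obtain ⟨b, hb, hbm⟩ := exists_smul_notMem_forall_smul_mem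
      (LinearMap.range (LinearMap.lsmul A (ι → A) x)) (y := a)
      (fun ⟨a', ha'⟩ => hcon ⟨a', ha'.symm⟩) k fun c hc => by
        obtain ⟨c', rfl⟩ := Ideal.mem_span_singleton'.1 (hk hc)
        exact ⟨c' • a, by rw [LinearMap.lsmul_apply, smul_smul, mul_comm]⟩
    have h1 : ∀ i, ∃ c r, (b • a) i = c * s + x * r := by
      intro i
      obtain ⟨c, hc⟩ := mem_of_baer_quotient hB (a := (b • a) i) hsx fun c hc => by
        obtain ⟨a', ha'⟩ := hbm c hc
        exact Ideal.mem_span_singleton.2 ⟨a' i, (congrFun ha' i).symm⟩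
      obtain ⟨r, hr⟩ := Ideal.mem_span_singleton.1 hc
      exact ⟨c, r, by rw [← hr]; ring⟩
    choose c r hcr using h1
    have h2 : b • a = s • c + x • r := by
      ext i
      rw [hcr, Pi.add_apply, Pi.smul_apply, Pi.smul_apply, smul_eq_mul, smul_eq_mul, mul_comm s]
    have h3 : s • f c = x • (b • y - f r) := by
      have := congrArg f h2
      rw [map_smul, map_add, map_smul, map_smul, hy] at this
      rw [smul_sub, smul_comm x b, this, add_sub_cancel_right]
    have h4 : b • y - f r ∈ L := mem_torsion_augIdeal.2 fun z hz => by
      refine hxM.right_eq_zero_of_smul ?_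
      rw [smul_comm, ← h3, smul_smul, (hs z).2 hz, zero_smul]
    have h5 : (e.symm fun i => Ideal.Quotient.mk _ (c i)) = x • (⟨_, h4⟩ : L) :=
      Subtype.ext ((hf c).symm.trans h3)
    rw [LinearEquiv.symm_apply_eq, map_smul] at h5
    choose c' hc' using fun i => Ideal.Quotient.mk_surjective (e ⟨_, h4⟩ i)
    refine hb ⟨s • c' + r, ?_⟩
    rw [h2, LinearMap.lsmul_apply, smul_add]
    congr 1
    ext i
    have h6 := congrFun h5 i
    rw [Pi.smul_apply, ← hc', Algebra.smul_def] at h6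
    have h7 : c i - x * c' i ∈ augIdeal lam := (Ideal.Quotient.mk_eq_mk_iff_sub_mem _ _).1 h6
    have h8 := (hs _).2 h7
    simp only [Pi.smul_apply, smul_eq_mul]
    linear_combination -h8
  refine ⟨f, ?_, ?_⟩
  · rw [← LinearMap.ker_eq_bot]
    refine Submodule.eq_bot_of_le_smul_of_le_jacobson_bot (maximalIdeal A) _
      (IsNoetherian.noetherian _) (fun a ha => ?_) (maximalIdeal_le_jacobson _)
    obtain ⟨a', rfl⟩ := key a ⟨0, by rw [smul_zero, LinearMap.mem_ker.1 ha]⟩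
    refine Submodule.smul_mem_smul hxm (LinearMap.mem_ker.2 (hxM.right_eq_zero_of_smul ?_))
    rw [← map_smul, LinearMap.mem_ker.1 ha]
  · rw [isSMulRegular_quotient_iff_mem_of_smul_mem]
    rintro y ⟨a, ha⟩
    obtain ⟨a', rfl⟩ := key a ⟨y, ha⟩
    refine ⟨a', hxM ?_⟩
    change x • f a' = x • y
    rw [← map_smul, ha]

end Embedding

/-! ### Lengths of quotients -/

section Colength

variable {A : Type u} [CommRing A] {N : Type w} [AddCommGroup N] [Module A N]

theorem length_quotient_eq_add_of_le {P Q : Submodule A N} (h : P ≤ Q) :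
    Module.length A (N ⧸ P) =
      Module.length A (Submodule.map P.mkQ Q) + Module.length A (N ⧸ Q) := by
  refine Module.length_eq_add_of_exact (Submodule.map P.mkQ Q).subtype (Submodule.factor h)
    (Submodule.injective_subtype _) (Submodule.factor_surjective h) fun y => ?_
  obtain ⟨n, rfl⟩ := Submodule.Quotient.mk_surjective _ y
  change Submodule.Quotient.mk (p := Q) n = 0 ↔ _
  rw [Submodule.Quotient.mk_eq_zero]
  constructor
  · exact fun hn => ⟨⟨_, n, hn, rfl⟩, rfl⟩
  · rintro ⟨⟨_, q, hq, rfl⟩, hy⟩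
    have h1 := (Submodule.Quotient.eq P).1 hy
    rw [← sub_sub_cancel q n]
    exact sub_mem hq (h h1)

/-- If multiplication by `z` embeds `Q ⧸ P` into `Q' ⧸ P'`, then `length (Q ⧸ P)` is at most
`length (Q' ⧸ P')`; the lengths are written as differences of colengths. -/
theorem length_quotient_add_le {P Q P' Q' : Submodule A N} (hPQ : P ≤ Q) (hPQ' : P' ≤ Q') (z : A)
    (hQ : ∀ n ∈ Q, z • n ∈ Q') (hP : ∀ n ∈ P, z • n ∈ P') (hinj : ∀ n ∈ Q, z • n ∈ P' → n ∈ P) :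
    Module.length A (N ⧸ P) + Module.length A (N ⧸ Q') ≤
      Module.length A (N ⧸ P') + Module.length A (N ⧸ Q) := by
  rw [length_quotient_eq_add_of_le hPQ, length_quotient_eq_add_of_le hPQ', add_assoc, add_assoc,
    add_comm (Module.length A (N ⧸ Q)) (Module.length A (N ⧸ Q'))]
  refine add_le_add_left (α := ℕ∞) ?_ _
  let g : N ⧸ P →ₗ[A] N ⧸ P' := P.mapQ P' (LinearMap.lsmul A N z) hP
  have hg : ∀ y ∈ Submodule.map P.mkQ Q, g y ∈ Submodule.map P'.mkQ Q' := by
    rintro _ ⟨n, hn, rfl⟩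
    exact ⟨z • n, hQ n hn, rfl⟩
  refine Module.length_le_of_injective (g.restrict hg) ?_
  rw [← LinearMap.ker_eq_bot, LinearMap.ker_eq_bot']
  rintro ⟨_, n, hn, rfl⟩ hy
  refine Subtype.ext ?_
  have h1 : Submodule.Quotient.mk (p := P') (z • n) = 0 := congrArg Subtype.val hy
  rw [Submodule.Quotient.mk_eq_zero] at h1
  exact (Submodule.Quotient.mk_eq_zero P).2 (hinj n hn h1)

theorem length_quotient_map_lsmul {x : A} (hx : IsSMulRegular N x) (P : Submodule A N) :
    Module.length A (N ⧸ P.map (LinearMap.lsmul A N x)) =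
      Module.length A (N ⧸ P) + Module.length A (N ⧸ LinearMap.range (LinearMap.lsmul A N x)) := by
  have hle : P.map (LinearMap.lsmul A N x) ≤ LinearMap.range (LinearMap.lsmul A N x) :=
    LinearMap.map_le_range
  refine Module.length_eq_add_of_exact
    (P.mapQ _ (LinearMap.lsmul A N x) (Submodule.le_comap_map _ _)) (Submodule.factor hle) ?_
    (Submodule.factor_surjective hle) fun y => ?_
  · rw [← LinearMap.ker_eq_bot, LinearMap.ker_eq_bot']
    intro y hy
    obtain ⟨n, rfl⟩ := Submodule.Quotient.mk_surjective _ y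
    obtain ⟨n', hn', hnn⟩ := (Submodule.Quotient.mk_eq_zero _).1 hy
    rw [Submodule.Quotient.mk_eq_zero, ← hx hnn]
    exact hn'
  · obtain ⟨n, rfl⟩ := Submodule.Quotient.mk_surjective _ y
    change Submodule.Quotient.mk (p := LinearMap.range (LinearMap.lsmul A N x)) n = 0 ↔ _
    rw [Submodule.Quotient.mk_eq_zero]
    constructor
    · rintro ⟨n', rfl⟩
      exact ⟨Submodule.Quotient.mk n', rfl⟩
    · rintro ⟨y', hy'⟩
      obtain ⟨n', rfl⟩ := Submodule.Quotient.mk_surjective _ y'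
      have h1 := (Submodule.Quotient.eq _).1 hy'
      rw [← sub_sub_cancel (x • n') n]
      exact sub_mem ⟨n', rfl⟩ (hle h1)

end Colength

/-! ### Nilpotent torsion in the associated graded module -/

section EventuallyKilled

variable {A : Type u} [CommRing A] (I : Ideal A) {N : Type w} [AddCommGroup N] [Module A N]

/-- For `u ∈ Iⁿ N`, membership in `eventuallyKilled I z n` says that the class of `u` in the degree
`n` part of the associated graded module of `N` is killed by a power of the class of `z ∈ I` in
degree one. -/
def eventuallyKilled (z : A) (n : ℕ) : Submodule A N where
  carrier := {u | ∃ c₀, ∀ c, c₀ ≤ c → z ^ c • u ∈ I ^ (n + c + 1) • (⊤ : Submodule A N)}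
  zero_mem' := ⟨0, fun c _ => by rw [smul_zero]; exact zero_mem _⟩
  add_mem' := by
    rintro a b ⟨c₁, h₁⟩ ⟨c₂, h₂⟩
    refine ⟨max c₁ c₂, fun c hc => ?_⟩
    rw [smul_add]
    exact add_mem (h₁ c (le_of_max_le_left hc)) (h₂ c (le_of_max_le_right hc))
  smul_mem' := by
    rintro a b ⟨c₁, h₁⟩
    refine ⟨c₁, fun c hc => ?_⟩
    rw [smul_comm]
    exact Submodule.smul_mem _ _ (h₁ c hc)

variable {I}

theorem smul_mem_pow_smul_top {j k l : ℕ} (hl : l = j + k) {y : A} (hy : y ∈ I ^ j) {u : N}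
    (hu : u ∈ I ^ k • (⊤ : Submodule A N)) : y • u ∈ I ^ l • (⊤ : Submodule A N) := by
  rw [hl, pow_add, Submodule.mul_smul]
  exact Submodule.smul_mem_smul hy hu

theorem pow_smul_top_le_eventuallyKilled {z : A} (hz : z ∈ I) (n : ℕ) :
    I ^ (n + 1) • (⊤ : Submodule A N) ≤ eventuallyKilled I z n := fun _ hu =>
  ⟨0, fun c _ => smul_mem_pow_smul_top (by ring) (Ideal.pow_mem_pow hz c) hu⟩

theorem smul_mem_eventuallyKilled {z y : A} (hy : y ∈ I) {n : ℕ} {u : N}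
    (hu : u ∈ eventuallyKilled I z n) : y • u ∈ eventuallyKilled I z (n + 1) := by
  obtain ⟨c₀, h⟩ := hu
  refine ⟨c₀, fun c hc => ?_⟩
  rw [smul_comm]
  exact smul_mem_pow_smul_top (j := 1) (by ring) (by rwa [pow_one]) (h c hc)

theorem mem_eventuallyKilled_of_smul_mem {z : A} {n : ℕ} {u : N}
    (hu : z • u ∈ eventuallyKilled I z (n + 1)) : u ∈ eventuallyKilled I z n := by
  obtain ⟨c₀, h⟩ := hu
  refine ⟨c₀ + 1, fun c hc => ?_⟩
  obtain ⟨c, rfl⟩ := Nat.exists_eq_add_of_le' (Nat.le_of_add_left_le hc)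
  have h1 := h c (by omega)
  rw [smul_smul, ← pow_succ] at h1
  convert h1 using 3
  ring

/-- If each element of `S ⊆ I` has a power killing the class of `u`, then so has the ideal
generated by `S`. -/
theorem exists_pow_span_smul_mem (S : Finset A) (hS : ∀ z ∈ S, z ∈ I) (n : ℕ) {u : N}
    (hu : ∀ z ∈ S, u ∈ eventuallyKilled I z n) :
    ∃ K, ∀ k, K ≤ k → ∀ a ∈ Ideal.span (S : Set A) ^ k,
      a • u ∈ I ^ (n + k + 1) • (⊤ : Submodule A N) := by
  classical
  induction S using Finset.induction_on with
  | empty =>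
    refine ⟨1, fun k hk a ha => ?_⟩
    rw [Finset.coe_empty, Ideal.span_empty, ← Ideal.zero_eq_bot, zero_pow (by omega),
      Ideal.zero_eq_bot, Ideal.mem_bot] at ha
    rw [ha, zero_smul]
    exact zero_mem _
  | insert z S hzS ih =>
    obtain ⟨K, hK⟩ := ih (fun y hy => hS y (Finset.mem_insert_of_mem hy))
      (fun y hy => hu y (Finset.mem_insert_of_mem hy))
    obtain ⟨c₀, hc₀⟩ := hu z (Finset.mem_insert_self z S)
    have hSI : Ideal.span (S : Set A) ≤ I :=
      Ideal.span_le.2 fun y hy => hS y (Finset.mem_insert_of_mem hy)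
    refine ⟨c₀ + K, fun k hk => ?_⟩
    suffices h : Ideal.span ((insert z S : Finset A) : Set A) ^ k ≤
        (I ^ (n + k + 1) • (⊤ : Submodule A N)).comap (LinearMap.toSpanSingleton A N u) from
      fun a ha => h ha
    rw [Finset.coe_insert, Ideal.span_insert, ← Ideal.add_eq_sup, add_pow]
    refine Finset.sum_induction _ (· ≤ (I ^ (n + k + 1) • (⊤ : Submodule A N)).comap
      (LinearMap.toSpanSingleton A N u)) (fun _ _ => sup_le) bot_le fun i hi => ?_
    have hik : i ≤ k := Nat.lt_succ_iff.1 (Finset.mem_range.1 hi)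
    refine Ideal.mul_le_left.trans ?_
    rw [Ideal.span_singleton_pow, Ideal.mul_le]
    intro a ha b hb
    obtain ⟨c, rfl⟩ := Ideal.mem_span_singleton'.1 ha
    change (c * z ^ i * b) • u ∈ I ^ (n + k + 1) • (⊤ : Submodule A N)
    rw [mul_assoc, mul_smul]
    refine Submodule.smul_mem _ _ ?_
    by_cases hi0 : c₀ ≤ i
    · rw [mul_comm, mul_smul]
      exact smul_mem_pow_smul_top (by omega) (Ideal.pow_right_mono hSI _ hb) (hc₀ i hi0)
    · rw [mul_smul]
      exact smul_mem_pow_smul_top (by omega)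
        (Ideal.pow_mem_pow (hS z (Finset.mem_insert_self z S)) i) (hK (k - i) (by omega) b hb)

end EventuallyKilled

section GradedSocle

variable {A : Type u} [CommRing A] (I : Ideal A) (N : Type w) [AddCommGroup N] [Module A N]

/-- The submodule of those `u ∈ Iⁿ N` whose class in the associated graded module of `N` is
killed by a power of each `z ∈ S`. -/
def killedBy (S : Finset A) (n : ℕ) : Submodule A N :=
  I ^ n • (⊤ : Submodule A N) ⊓ ⨅ z ∈ S, eventuallyKilled I z n

variable {I N}

theorem mem_killedBy {S : Finset A} {n : ℕ} {u : N} : u ∈ killedBy I N S n ↔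
    u ∈ I ^ n • (⊤ : Submodule A N) ∧ ∀ z ∈ S, u ∈ eventuallyKilled I z n := by
  simp [killedBy]

theorem pow_smul_top_le_killedBy {S : Finset A} (hS : ∀ z ∈ S, z ∈ I) (n : ℕ) :
    I ^ (n + 1) • (⊤ : Submodule A N) ≤ killedBy I N S n := fun _ hu =>
  mem_killedBy.2 ⟨Submodule.smul_mono_left (Ideal.pow_le_pow_right n.le_succ) hu,
    fun z hz => pow_smul_top_le_eventuallyKilled (hS z hz) n hu⟩

theorem smul_mem_killedBy {S : Finset A} {n : ℕ} {y : A} (hy : y ∈ I) {u : N}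
    (hu : u ∈ killedBy I N S n) : y • u ∈ killedBy I N S (n + 1) := by
  rw [mem_killedBy] at hu ⊢
  exact ⟨smul_mem_pow_smul_top (add_comm n 1) (by rwa [pow_one]) hu.1,
    fun z hz => smul_mem_eventuallyKilled hy (hu.2 z hz)⟩

/-- If `S` generates `I`, then only finitely many degrees of the associated graded module contain
nonzero elements killed by powers of all elements of `S`. -/
theorem exists_forall_killedBy_eq [IsNoetherianRing A] [Module.Finite A N] {S : Finset A}
    (hS : Ideal.span (S : Set A) = I) :
    ∃ n₀, ∀ n, n₀ ≤ n → killedBy I N S n = I ^ (n + 1) • (⊤ : Submodule A N) := by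
  have hSI : ∀ z ∈ S, z ∈ I := fun z hz => hS ▸ Ideal.subset_span hz
  let W : I.Filtration N :=
    { N := killedBy I N S
      mono := fun n => le_trans (fun u hu => (mem_killedBy.1 hu).1) (pow_smul_top_le_killedBy hSI n)
      smul_le := fun n => Submodule.smul_le.2 fun y hy u hu => smul_mem_killedBy hy hu }
  have hW : W.Stable := (I.stableFiltration_stable (⊤ : Submodule A N)).of_le fun n u hu =>
    (mem_killedBy.1 hu).1
  -- By stability `W (n₁ + k) = I ^ k • W n₁`, and a high power of `I` moves the finitely many
  -- generators of `W n₁` one degree deeper than expected.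
  obtain ⟨n₁, hn₁⟩ := hW.exists_pow_smul_eq
  obtain ⟨G, hG⟩ := IsNoetherian.noetherian (killedBy I N S n₁)
  have hGK : ∀ u : N, ∃ K, u ∈ G → ∀ k, K ≤ k → ∀ a ∈ I ^ k,
      a • u ∈ I ^ (n₁ + k + 1) • (⊤ : Submodule A N) := by
    intro u
    by_cases hu : u ∈ G
    · have hu' : u ∈ killedBy I N S n₁ := hG ▸ Submodule.subset_span hu
      obtain ⟨K, hK⟩ := exists_pow_span_smul_mem S hSI n₁ (mem_killedBy.1 hu').2
      rw [hS] at hK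
      exact ⟨K, fun _ => hK⟩
    · exact ⟨0, fun h => absurd h hu⟩
  choose K hK using hGK
  refine ⟨n₁ + G.sup K, fun n hn => le_antisymm ?_ (pow_smul_top_le_killedBy hSI n)⟩
  obtain ⟨k, rfl⟩ := Nat.exists_eq_add_of_le (Nat.le_of_add_right_le hn)
  have h1 : killedBy I N S (n₁ + k) = I ^ k • killedBy I N S n₁ := hn₁ k
  rw [h1, ← hG, Submodule.smul_le]
  intro a ha u hu
  induction hu using Submodule.span_induction with
  | mem u hu => exact hK u hu k ((Finset.le_sup hu).trans (by omega)) a ha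
  | zero => rw [smul_zero]; exact zero_mem _
  | add u v _ _ hu hv => rw [smul_add]; exact add_mem hu hv
  | smul b u _ hu => rw [smul_comm]; exact Submodule.smul_mem _ _ hu

end GradedSocle

/-! ### The Hilbert function in dimension one -/

section HilbertFunction

open IsLocalRing Filter Topology

theorem eventually_eq_of_monotone_of_le {g : ℕ → ℕ} (hg : Monotone g) {B : ℕ} (hB : ∀ n, g n ≤ B) :
    ∃ b n₀, ∀ n, n₀ ≤ n → g n = b := by
  obtain ⟨n₀, hn₀⟩ := WellFoundedGT.monotone_chain_condition
    (⟨fun n => (⟨g n, Nat.lt_succ_of_le (hB n)⟩ : Fin (B + 1)), fun i j hij => hg hij⟩ :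
      ℕ →o Fin (B + 1))
  exact ⟨g n₀, n₀, fun n hn => (congrArg Fin.val (hn₀ n hn)).symm⟩

variable {A : Type u} [CommRing A] [IsLocalRing A] {N : Type w} [AddCommGroup N] [Module A N]

/-- If `x ∈ 𝔪` is regular on `N`, then `length (𝔪ⁿN / 𝔪ⁿ⁺¹N)` is at most `length (N / xN)`. -/
theorem length_quotient_pow_succ_le {x : A} (hxm : x ∈ maximalIdeal A) (hx : IsSMulRegular N x)
    (n : ℕ) : Module.length A (N ⧸ maximalIdeal A ^ (n + 1) • (⊤ : Submodule A N)) ≤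
      Module.length A (N ⧸ maximalIdeal A ^ n • (⊤ : Submodule A N)) +
        Module.length A (N ⧸ LinearMap.range (LinearMap.lsmul A N x)) := by
  rw [← length_quotient_map_lsmul hx]
  refine Module.length_le_of_surjective (Submodule.factor ?_) (Submodule.factor_surjective _)
  rintro _ ⟨n', hn', rfl⟩
  exact smul_mem_pow_smul_top (j := 1) (add_comm n 1) (by rwa [pow_one]) hn'

variable [IsNoetherianRing A] [Module.Finite A N]

variable (A) in
theorem length_quotient_ne_top_of_pow_le {P : Submodule A N} {k : ℕ}
    (hP : maximalIdeal A ^ k • (⊤ : Submodule A N) ≤ P) : Module.length A (N ⧸ P) ≠ ⊤ := by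
  refine length_ne_top_of_pow_smul_eq_zero (k := k) fun a ha y => ?_
  obtain ⟨n, rfl⟩ := Submodule.Quotient.mk_surjective _ y
  rw [← Submodule.Quotient.mk_smul, Submodule.Quotient.mk_eq_zero]
  exact hP (Submodule.smul_mem_smul ha trivial)

/-- In dimension one the Hilbert function `n ↦ length (𝔪ⁿN / 𝔪ⁿ⁺¹N)` is eventually constant. For
finite `S ⊆ 𝔪` filter the associated graded module by the submodules of elements killed by powers
of all elements of `S`. On the quotient of the submodules for `S` and `S ∪ {z}`,
multiplication by `z` is injective, so its Hilbert function is nondecreasing; being bounded, it is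
eventually constant. If `S` generates `𝔪`, then the submodule is zero in large degrees. -/
theorem exists_forall_length_quotient_pow_eq {x : A} (hxm : x ∈ maximalIdeal A)
    (hx : IsSMulRegular N x) {c : ℕ} (hc : maximalIdeal A ^ c ≤ Ideal.span {x}) :
    ∃ h n₀ : ℕ, ∀ n, n₀ ≤ n →
      (Module.length A (N ⧸ maximalIdeal A ^ (n + 1) • (⊤ : Submodule A N))).toNat =
      (Module.length A (N ⧸ maximalIdeal A ^ n • (⊤ : Submodule A N))).toNat + h := by
  classical
  have hE : Module.length A (N ⧸ LinearMap.range (LinearMap.lsmul A N x)) ≠ ⊤ := by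
    refine length_quotient_ne_top_of_pow_le A (k := c) (Submodule.smul_le.2 fun a ha y _ => ?_)
    obtain ⟨b, rfl⟩ := Ideal.mem_span_singleton'.1 (hc ha)
    exact ⟨b • y, by rw [LinearMap.lsmul_apply, smul_smul, mul_comm]⟩
  have hF : ∀ n, Module.length A (N ⧸ maximalIdeal A ^ n • (⊤ : Submodule A N)) ≠ ⊤ := fun n =>
    length_quotient_ne_top_of_pow_le A le_rfl
  have main : ∀ S : Finset A, (∀ z ∈ S, z ∈ maximalIdeal A) → ∃ h n₀ : ℕ, ∀ n, n₀ ≤ n →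
      (Module.length A (N ⧸ killedBy (maximalIdeal A) N S n)).toNat =
      (Module.length A (N ⧸ maximalIdeal A ^ n • (⊤ : Submodule A N))).toNat + h := by
    intro S
    induction S using Finset.induction_on with
    | empty =>
      refine fun _ => ⟨0, 0, fun n _ => ?_⟩
      have : killedBy (maximalIdeal A) N ∅ n = maximalIdeal A ^ n • ⊤ := by simp [killedBy]
      rw [this, add_zero]
    | insert z S hzS ih =>
      intro hS
      have hzm := hS z (Finset.mem_insert_self z S)
      have hSm : ∀ y ∈ S, y ∈ maximalIdeal A := fun y hy => hS y (Finset.mem_insert_of_mem hy)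
      obtain ⟨h, n₀, hn₀⟩ := ih hSm
      let P : ℕ → Submodule A N := killedBy (maximalIdeal A) N (insert z S)
      let Q : ℕ → Submodule A N := killedBy (maximalIdeal A) N S
      have hP : ∀ n, Module.length A (N ⧸ P n) ≠ ⊤ := fun n =>
        length_quotient_ne_top_of_pow_le A (pow_smul_top_le_killedBy hS n)
      have hQ : ∀ n, Module.length A (N ⧸ Q n) ≠ ⊤ := fun n =>
        length_quotient_ne_top_of_pow_le A (pow_smul_top_le_killedBy hSm n)
      have hPQ : ∀ n, P n ≤ Q n := fun n u hu => by
        obtain ⟨h1, h2⟩ := mem_killedBy.1 hu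
        exact mem_killedBy.2 ⟨h1, fun y hy => h2 y (Finset.mem_insert_of_mem hy)⟩
      have hPF : ∀ n, (Module.length A (N ⧸ P n)).toNat ≤
          (Module.length A (N ⧸ Q n)).toNat +
          (Module.length A (N ⧸ LinearMap.range (LinearMap.lsmul A N x))).toNat := fun n => by
        rw [← ENat.toNat_add (hQ n) hE]
        refine ENat.toNat_le_toNat ?_ (WithTop.add_ne_top.2 ⟨hQ n, hE⟩)
        refine (Module.length_le_of_surjective _ (Submodule.factor_surjective
          (pow_smul_top_le_killedBy hS n))).trans
            ((length_quotient_pow_succ_le hxm hx n).trans ?_)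
        refine add_le_add_left (Module.length_le_of_surjective _ (Submodule.factor_surjective
          fun u hu => (mem_killedBy.1 hu).1)) _
      have hQP : ∀ n, (Module.length A (N ⧸ Q n)).toNat ≤ (Module.length A (N ⧸ P n)).toNat :=
        fun n => ENat.toNat_le_toNat (Module.length_le_of_surjective _
          (Submodule.factor_surjective (hPQ n))) (hP n)
      have hmono : ∀ n, (Module.length A (N ⧸ P n)).toNat +
          (Module.length A (N ⧸ Q (n + 1))).toNat ≤ (Module.length A (N ⧸ P (n + 1))).toNat +
          (Module.length A (N ⧸ Q n)).toNat := fun n => by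
        rw [← ENat.toNat_add (hP _) (hQ _), ← ENat.toNat_add (hP _) (hQ _)]
        refine ENat.toNat_le_toNat ?_ (WithTop.add_ne_top.2 ⟨hP _, hQ _⟩)
        refine length_quotient_add_le (hPQ n) (hPQ (n + 1)) z
          (fun u hu => smul_mem_killedBy hzm hu) (fun u hu => smul_mem_killedBy hzm hu)
          fun u hu hzu => ?_
        refine mem_killedBy.2 ⟨(mem_killedBy.1 hu).1, fun y hy => ?_⟩
        rcases Finset.mem_insert.1 hy with rfl | hy
        · exact mem_eventuallyKilled_of_smul_mem
            ((mem_killedBy.1 hzu).2 y (Finset.mem_insert_self y S))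
        · exact (mem_killedBy.1 hu).2 y hy
      obtain ⟨b, n₁, hn₁⟩ := eventually_eq_of_monotone_of_le
        (g := fun n => (Module.length A (N ⧸ P n)).toNat - (Module.length A (N ⧸ Q n)).toNat)
        (B := (Module.length A (N ⧸ LinearMap.range (LinearMap.lsmul A N x))).toNat)
        (monotone_nat_of_le_succ fun n => by
          have := hmono n; have := hQP n; have := hQP (n + 1); omega)
        (fun n => by have := hPF n; omega)
      refine ⟨h + b, max n₀ n₁, fun n hn => ?_⟩
      have h1 := hn₀ n (le_of_max_le_left hn)
      have h2 := hn₁ n (le_of_max_le_right hn)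
      have h3 := hQP n
      change (Module.length A (N ⧸ Q n)).toNat = _ at h1
      change (Module.length A (N ⧸ P n)).toNat = _
      omega
  obtain ⟨S, hS⟩ := IsNoetherian.noetherian (maximalIdeal A)
  obtain ⟨h, n₀, hn₀⟩ := main S fun z hz => hS ▸ Submodule.subset_span hz
  obtain ⟨n₁, hn₁⟩ := exists_forall_killedBy_eq (N := N) (I := maximalIdeal A) hS
  refine ⟨h, max n₀ n₁, fun n hn => ?_⟩
  rw [← hn₀ n (le_of_max_le_left hn), hn₁ n (le_of_max_le_right hn)]

theorem exists_tendsto_length_div {x : A} (hxm : x ∈ maximalIdeal A)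
    (hx : IsSMulRegular N x) {c : ℕ} (hc : maximalIdeal A ^ c ≤ Ideal.span {x}) :
    ∃ h : ℝ, Tendsto (fun n : ℕ =>
      ((Module.length A (N ⧸ maximalIdeal A ^ n • (⊤ : Submodule A N))).toNat : ℝ) / n)
      atTop (𝓝 h) := by
  obtain ⟨h, n₀, hn₀⟩ := exists_forall_length_quotient_pow_eq hxm hx hc
  let a : ℕ → ℕ := fun n => (Module.length A (N ⧸ maximalIdeal A ^ n • (⊤ : Submodule A N))).toNat
  have ha : ∀ k, a (n₀ + k) = a n₀ + k * h := by
    intro k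
    induction k with
    | zero => simp
    | succ k ih =>
      have h1 : a (n₀ + k + 1) = a (n₀ + k) + h := hn₀ (n₀ + k) (Nat.le_add_right _ _)
      rw [← add_assoc, h1, ih]
      ring
  refine ⟨h, ?_⟩
  have h1 : Tendsto (fun n : ℕ => (h : ℝ) + ((a n₀ : ℝ) - n₀ * h) / n) atTop (𝓝 (h + 0)) :=
    tendsto_const_nhds.add (tendsto_const_div_atTop_nhds_zero_nat _)
  rw [add_zero] at h1
  refine h1.congr' ?_
  filter_upwards [eventually_ge_atTop n₀, eventually_gt_atTop 0] with n hn hn0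
  obtain ⟨k, rfl⟩ := Nat.exists_eq_add_of_le hn
  change _ = (a (n₀ + k) : ℝ) / _
  have : ((n₀ + k : ℕ) : ℝ) ≠ 0 := by positivity
  rw [ha, eq_div_iff this, add_mul, div_mul_cancel₀ _ this]
  push_cast
  ring

/-- In a one-dimensional ring the limit defining the Hilbert–Samuel multiplicity of `N` exists, if
some `x ∈ 𝔪` with `A ⧸ (x)` artinian is regular on `N`. -/
theorem tendsto_hsMultiplicity (hd : dimNat A = 1) {x : A} (hxm : x ∈ maximalIdeal A)
    (hx : IsSMulRegular N x) {c : ℕ} (hc : maximalIdeal A ^ c ≤ Ideal.span {x}) :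
    Tendsto (fun n : ℕ =>
      ((Module.length A (N ⧸ maximalIdeal A ^ n • (⊤ : Submodule A N))).toNat : ℝ) / n)
      atTop (𝓝 (hsMultiplicity A N)) := by
  have h := tendsto_nhds_limUnder (exists_tendsto_length_div hxm hx hc)
  simpa [hsMultiplicity, hd] using h

end HilbertFunction

/-! ### Free modules -/

section FreeModules

open IsLocalRing

variable {A : Type u} [CommRing A] {M : Type w} [AddCommGroup M] [Module A M]

theorem repr_mem_of_mem_ideal_smul_top {ι : Type*} (b : Module.Basis ι A M) (J : Ideal A) {m : M}
    (hm : m ∈ J • (⊤ : Submodule A M)) (i : ι) : b.repr m i ∈ J := by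
  refine Submodule.smul_induction_on hm (fun a ha y _ => ?_) fun y z hy hz => ?_
  · rw [map_smul, Finsupp.smul_apply]
    exact Ideal.mul_mem_right _ _ ha
  · rw [map_add, Finsupp.add_apply]
    exact add_mem hy hz

theorem length_quotient_smul_top_of_basis {ι : Type*} [Fintype ι] (b : Module.Basis ι A M)
    (J : Ideal A) : Module.length A (M ⧸ J • (⊤ : Submodule A M)) =
      Fintype.card ι * Module.length A (A ⧸ J • (⊤ : Submodule A A)) := by
  have hJ : J • (⊤ : Submodule A A) = J := by rw [smul_eq_mul]; exact Ideal.mul_top J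
  let φ : M →ₗ[A] (ι → A ⧸ J • (⊤ : Submodule A A)) :=
    LinearMap.pi (fun i => (J • (⊤ : Submodule A A)).mkQ ∘ₗ LinearMap.proj i) ∘ₗ
      b.equivFun.toLinearMap
  have hφ : Function.Surjective φ := by
    intro y
    choose a ha using fun i => Submodule.Quotient.mk_surjective _ (y i)
    refine ⟨b.equivFun.symm a, ?_⟩
    ext i
    change Submodule.Quotient.mk (b.equivFun (b.equivFun.symm a) i) = y i
    rw [LinearEquiv.apply_symm_apply, ha]
  have hker : LinearMap.ker φ = J • (⊤ : Submodule A M) := by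
    ext m
    have h1 : m ∈ LinearMap.ker φ ↔ ∀ i, b.repr m i ∈ J := by
      rw [LinearMap.mem_ker, funext_iff]
      refine forall_congr' fun i => ?_
      change Submodule.Quotient.mk (p := J • (⊤ : Submodule A A)) (b.repr m i) = 0 ↔ _
      rw [Submodule.Quotient.mk_eq_zero, hJ]
    rw [h1]
    refine ⟨fun h => ?_, repr_mem_of_mem_ideal_smul_top b J⟩
    rw [← b.sum_repr m]
    exact sum_mem fun i _ => Submodule.smul_mem_smul (h i) trivial
  rw [← hker, (φ.quotKerEquivOfSurjective hφ).length_eq, Module.length_pi_of_fintype]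
  simp

variable {O : Type v} [CommRing O] {lam : A →+* O}

theorem nonempty_torsion_equiv_of_basis {ι : Type*} (b : Module.Basis ι A M) [Finite ι] {s : A}
    (hs : ∀ c, c * s = 0 ↔ c ∈ augIdeal lam) (hI : annIdeal lam = Ideal.span {s}) :
    Nonempty (Submodule.torsionBySet A M (augIdeal lam : Set A) ≃ₗ[A] (ι → A ⧸ augIdeal lam)) := by
  obtain ⟨e⟩ := nonempty_torsion_self_equiv hs hI
  let e₁ : Submodule.torsionBySet A M (augIdeal lam : Set A) ≃ₗ[A]
      (ι → Submodule.torsionBySet A A (augIdeal lam : Set A)) :=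
    { toFun := fun l i => ⟨b.equivFun l.1 i, mem_torsion_augIdeal.2 fun c hc => by
        rw [← Pi.smul_apply, ← map_smul, mem_torsion_augIdeal.1 l.2 c hc, map_zero,
          Pi.zero_apply]⟩
      invFun := fun a => ⟨b.equivFun.symm fun i => (a i).1, mem_torsion_augIdeal.2 fun c hc => by
        have h : (c • fun i => (a i).1) = 0 :=
          funext fun i => mem_torsion_augIdeal.1 (a i).2 c hc
        rw [← map_smul, h, map_zero]⟩
      map_add' := fun l l' => by
        ext i
        simp
      map_smul' := fun c l => by
        ext i
        simp
      left_inv := fun l => Subtype.ext (b.equivFun.symm_apply_apply l.1)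
      right_inv := fun a => funext fun i => Subtype.ext
        (congrFun (b.equivFun.apply_symm_apply fun i => (a i).1) i) }
  exact ⟨e₁ ≪≫ₗ LinearEquiv.piCongrRight fun _ => e ≪≫ₗ LinearEquiv.funUnique Unit A _⟩

theorem torsion_le_range_of_basis {ι : Type*} [Finite ι] (b : Module.Basis ι A M) {s : A}
    (hI : annIdeal lam = Ideal.span {s}) :
    Submodule.torsionBySet A M (augIdeal lam : Set A) ≤
      LinearMap.range (LinearMap.lsmul A M s) := by
  intro m hm
  have h1 : ∀ i, ∃ c, c * s = b.equivFun m i := fun i => by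
    rw [← Ideal.mem_span_singleton', ← hI, mem_annIdeal]
    intro c hc
    rw [← smul_eq_mul, ← Pi.smul_apply, ← map_smul, mem_torsion_augIdeal.1 hm c hc, map_zero,
      Pi.zero_apply]
  choose c hc using h1
  refine ⟨b.equivFun.symm c, ?_⟩
  rw [LinearMap.lsmul_apply, ← map_smul, LinearEquiv.symm_apply_eq]
  ext i
  rw [← hc, Pi.smul_apply, smul_eq_mul, mul_comm]

end FreeModules

/-! ### Comparison of multiplicities -/

section Multiplicity

open IsLocalRing Filter Topology

variable {A : Type u} [CommRing A] [IsLocalRing A] [IsNoetherianRing A]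
  {M : Type w} [AddCommGroup M] [Module A M] [Module.Finite A M]

/-- By Nakayama's lemma the chain `𝔪ⁿM` is strictly decreasing, since `xⁿ ∈ 𝔪ⁿ` does not
kill `M`. -/
theorem le_length_quotient_pow [Nontrivial M] {x : A} (hxm : x ∈ maximalIdeal A)
    (hx : IsSMulRegular M x) (n : ℕ) :
    (n : ℕ∞) ≤ Module.length A (M ⧸ maximalIdeal A ^ n • (⊤ : Submodule A M)) := by
  induction n with
  | zero => simp
  | succ n ih =>
    have hle : maximalIdeal A ^ (n + 1) • (⊤ : Submodule A M) ≤ maximalIdeal A ^ n • ⊤ :=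
      Submodule.smul_mono_left (Ideal.pow_le_pow_right n.le_succ)
    rw [Nat.cast_succ, length_quotient_eq_add_of_le hle, add_comm (Module.length A _)]
    refine add_le_add ih (Order.one_le_iff_pos.2 (Module.length_pos_iff.2 ?_))
    by_contra hnt
    rw [not_nontrivial_iff_subsingleton, Submodule.subsingleton_iff_eq_bot, ← le_bot_iff,
      Submodule.map_le_iff_le_comap] at hnt
    have h1 : maximalIdeal A ^ n • (⊤ : Submodule A M) = ⊥ := by
      refine Submodule.eq_bot_of_le_smul_of_le_jacobson_bot (maximalIdeal A) _
        (IsNoetherian.noetherian _) (fun m hm => ?_) (maximalIdeal_le_jacobson _)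
      rw [← Submodule.mul_smul, ← pow_succ']
      exact (Submodule.Quotient.mk_eq_zero _).1 (hnt hm)
    obtain ⟨m, hm⟩ := exists_ne (0 : M)
    refine hm ((hx.pow n).right_eq_zero_of_smul ?_)
    rw [← Submodule.mem_bot A, ← h1]
    exact Submodule.smul_mem_smul (Ideal.pow_mem_pow hxm n) trivial

/-- By the Artin–Rees lemma, `length (M / 𝔪ⁿM)` is, up to a shift, at least the sum of the
corresponding lengths for a submodule and for the quotient by it. -/
theorem exists_length_add_le {F : Type x} [AddCommGroup F] [Module A F] {f : F →ₗ[A] M}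
    (hf : Function.Injective f) : ∃ k, ∀ n,
      Module.length A (F ⧸ maximalIdeal A ^ n • (⊤ : Submodule A F)) +
        Module.length A ((M ⧸ LinearMap.range f) ⧸ maximalIdeal A ^ (n + k) •
          (⊤ : Submodule A (M ⧸ LinearMap.range f))) ≤
      Module.length A (M ⧸ maximalIdeal A ^ (n + k) • (⊤ : Submodule A M)) := by
  obtain ⟨k, hk⟩ := (maximalIdeal A).exists_pow_inf_eq_pow_smul (LinearMap.range f)
  refine ⟨k, fun n => ?_⟩
  let P : Submodule A M := maximalIdeal A ^ (n + k) • ⊤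
  have hle : P.comap f ≤ maximalIdeal A ^ n • ⊤ := by
    intro a ha
    have h1 : f a ∈ maximalIdeal A ^ (n + k) • (⊤ : Submodule A M) ⊓ LinearMap.range f :=
      ⟨ha, a, rfl⟩
    rw [hk (n + k) (Nat.le_add_left _ _), Nat.add_sub_cancel] at h1
    have h2 : f a ∈ maximalIdeal A ^ n • LinearMap.range f :=
      Submodule.smul_mono le_rfl inf_le_right h1
    rw [LinearMap.range_eq_map, ← Submodule.map_smul''] at h2
    obtain ⟨a', ha', haa⟩ := h2
    rwa [← hf haa]
  have hC : P.map (LinearMap.range f).mkQ = maximalIdeal A ^ (n + k) • ⊤ := by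
    rw [Submodule.map_smul'', Submodule.map_top, Submodule.range_mkQ]
  rw [← hC]
  let α : F ⧸ P.comap f →ₗ[A] M ⧸ P := (P.comap f).mapQ P f le_rfl
  let β : M ⧸ P →ₗ[A] (M ⧸ LinearMap.range f) ⧸ P.map (LinearMap.range f).mkQ :=
    P.mapQ _ (LinearMap.range f).mkQ (Submodule.le_comap_map _ _)
  have hα : Function.Injective α := by
    rw [← LinearMap.ker_eq_bot, LinearMap.ker_eq_bot']
    intro y hy
    obtain ⟨a, rfl⟩ := Submodule.Quotient.mk_surjective _ y
    exact (Submodule.Quotient.mk_eq_zero _).2 ((Submodule.Quotient.mk_eq_zero P).1 hy)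
  have hβ : Function.Surjective β := by
    intro y
    obtain ⟨y, rfl⟩ := Submodule.Quotient.mk_surjective _ y
    obtain ⟨m, rfl⟩ := Submodule.Quotient.mk_surjective _ y
    exact ⟨Submodule.Quotient.mk m, rfl⟩
  have hex : Function.Exact α β := by
    intro y
    obtain ⟨m, rfl⟩ := Submodule.Quotient.mk_surjective _ y
    change Submodule.Quotient.mk (p := P.map (LinearMap.range f).mkQ)
      (Submodule.Quotient.mk (p := LinearMap.range f) m) = 0 ↔ _
    rw [Submodule.Quotient.mk_eq_zero]
    constructor
    · rintro ⟨m', hm', h⟩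
      obtain ⟨a, ha⟩ := (Submodule.Quotient.eq _).1 h
      refine ⟨Submodule.Quotient.mk (-a), ?_⟩
      change Submodule.Quotient.mk (p := P) (f (-a)) = Submodule.Quotient.mk m
      rw [Submodule.Quotient.eq, map_neg, ha]
      convert P.neg_mem hm' using 1
      abel
    · rintro ⟨y, hy⟩
      obtain ⟨a, rfl⟩ := Submodule.Quotient.mk_surjective _ y
      have h1 := (Submodule.Quotient.eq P).1 hy.symm
      refine ⟨m - f a, h1, (Submodule.Quotient.eq _).2 ⟨-a, ?_⟩⟩
      rw [map_neg]
      abel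
  rw [Module.length_eq_add_of_exact α β hα hβ hex]
  exact add_le_add_left (Module.length_le_of_surjective (Submodule.factor hle)
    (Submodule.factor_surjective hle)) _

theorem hsMultiplicity_eq_of_basis {x : A} (hd : dimNat A = 1) (hxm : x ∈ maximalIdeal A)
    (hxA : IsSMulRegular A x) (hxM : IsSMulRegular M x) {c : ℕ}
    (hc : maximalIdeal A ^ c ≤ Ideal.span {x}) {ι : Type*} [Fintype ι]
    (b : Module.Basis ι A M) :
    hsMultiplicity A M = Fintype.card ι * hsMultiplicity A A := by
  refine tendsto_nhds_unique (tendsto_hsMultiplicity hd hxm hxM hc) ?_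
  refine ((tendsto_hsMultiplicity hd hxm hxA hc).const_mul (Fintype.card ι : ℝ)).congr fun n => ?_
  rw [length_quotient_smul_top_of_basis b, ENat.toNat_mul, ENat.toNat_natCast, Nat.cast_mul,
    mul_div_assoc]

/-- If `A^ι ⊆ M` and some `x ∈ 𝔪` is regular on the nonzero cokernel `C`, then
`e(M) ≥ #ι · e(A) + 1`, because `length (C / 𝔪ⁿC) ≥ n`. -/
theorem add_one_le_hsMultiplicity {x : A} (hd : dimNat A = 1) (hxm : x ∈ maximalIdeal A)
    (hxA : IsSMulRegular A x) (hxM : IsSMulRegular M x) {c : ℕ}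
    (hc : maximalIdeal A ^ c ≤ Ideal.span {x}) {ι : Type*} [Fintype ι] {f : (ι → A) →ₗ[A] M}
    (hf : Function.Injective f) [Nontrivial (M ⧸ LinearMap.range f)]
    (hxC : IsSMulRegular (M ⧸ LinearMap.range f) x) :
    Fintype.card ι * hsMultiplicity A A + 1 ≤ hsMultiplicity A M := by
  obtain ⟨k, hk⟩ := exists_length_add_le hf
  have hA := tendsto_hsMultiplicity hd hxm hxA hc
  have hM := (tendsto_hsMultiplicity hd hxm hxM hc).comp (tendsto_add_atTop_nat k)
  have hratio : Tendsto (fun n : ℕ => ((n + k : ℕ) : ℝ) / n) atTop (𝓝 1) := by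
    have h1 : Tendsto (fun n : ℕ => (1 : ℝ) + (k : ℝ) / n) atTop (𝓝 (1 + 0)) :=
      tendsto_const_nhds.add (tendsto_const_div_atTop_nhds_zero_nat _)
    rw [add_zero] at h1
    refine h1.congr' ?_
    filter_upwards [eventually_gt_atTop 0] with n hn
    have : (n : ℝ) ≠ 0 := by positivity
    push_cast
    field_simp
  have hM' := hM.mul hratio
  rw [mul_one] at hM'
  refine le_of_tendsto_of_tendsto ((hA.const_mul (Fintype.card ι : ℝ)).add_const 1) hM' ?_
  filter_upwards [eventually_gt_atTop 0] with n hn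
  have h1 := (add_le_add_right (le_length_quotient_pow hxm hxC (n + k)) _).trans (hk n)
  rw [length_quotient_smul_top_of_basis (Pi.basisFun A ι)] at h1
  have hfin := length_quotient_ne_top_of_pow_le A
    (le_refl (maximalIdeal A ^ (n + k) • (⊤ : Submodule A M)))
  have hfinA := length_quotient_ne_top_of_pow_le A
    (le_refl (maximalIdeal A ^ n • (⊤ : Submodule A A)))
  have hfin₁ : (Fintype.card ι : ℕ∞) * Module.length A
      (A ⧸ maximalIdeal A ^ n • (⊤ : Submodule A A)) ≠ ⊤ :=
    WithTop.mul_ne_top (ENat.natCast_ne_top _) hfinA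
  have h2 := ENat.toNat_le_toNat h1 hfin
  rw [ENat.toNat_add hfin₁ (ENat.natCast_ne_top (n + k)),
    ENat.toNat_mul, ENat.toNat_natCast, ENat.toNat_natCast] at h2
  have hn0 : (0 : ℝ) < n := by positivity
  have hnk : (0 : ℝ) < ((n + k : ℕ) : ℝ) := by positivity
  simp only [Function.comp_apply]
  rw [div_mul_div_cancel₀ hnk.ne', ← mul_div_assoc, div_add_one hn0.ne']
  refine div_le_div_of_nonneg_right ?_ hn0.le
  have h3 : (Fintype.card ι : ℝ) * ((Module.length A
      (A ⧸ maximalIdeal A ^ n • (⊤ : Submodule A A))).toNat : ℝ) + (n + k : ℕ) ≤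
      ((Module.length A (M ⧸ maximalIdeal A ^ (n + k) • (⊤ : Submodule A M))).toNat : ℝ) := by
    exact_mod_cast h2
  push_cast at h3 ⊢
  have : (0 : ℝ) ≤ k := by positivity
  linarith

end Multiplicity

/-! ### Generic ranks -/

section GenericPoints

open IsLocalRing

variable {A : Type u} [CommRing A] {M : Type w} [AddCommGroup M] [Module A M] [Module.Finite A M]

/-- Nakayama's lemma at `q`: if the fibre of `M` at `q` has dimension at most `d`, then some
`A ^ d → M` becomes surjective after localizing at `q`. -/
theorem exists_notMem_support_of_rankAt_le (q : PrimeSpectrum A) {d : ℕ} (h : rankAt q M ≤ d) :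
    ∃ g : (Fin d → A) →ₗ[A] M, q ∉ Module.support A (M ⧸ LinearMap.range g) := by
  let K := q.asIdeal.ResidueField
  let S : Set (K ⊗[A] M) := Set.range fun m : M => (1 : K) ⊗ₜ[A] m
  have hS : Submodule.span K S = ⊤ := by
    refine top_le_iff.1 fun y _ => ?_
    induction y with
    | zero => exact zero_mem _
    | tmul k m =>
      have h1 : k ⊗ₜ[A] m = k • ((1 : K) ⊗ₜ[A] m) := by
        rw [TensorProduct.smul_tmul', smul_eq_mul, mul_one]
      rw [h1]
      exact Submodule.smul_mem _ _ (Submodule.subset_span ⟨m, rfl⟩)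
    | add y z hy hz => exact add_mem (hy trivial) (hz trivial)
  have hr : Module.finrank K (Submodule.span K S) = rankAt q M := by
    rw [hS, finrank_top, rankAt]
  obtain ⟨φ, hφ, hspan, -⟩ := Submodule.exists_fun_fin_finrank_span_eq K S
  choose m hm using hφ
  let m' : Fin d → M := fun i =>
    if hi : (i : ℕ) < Module.finrank K (Submodule.span K S) then m ⟨i, hi⟩ else 0
  refine ⟨Fintype.linearCombination A m', ?_⟩
  rw [Module.mem_support_iff_nontrivial_residueField_tensorProduct, not_nontrivial_iff_subsingleton]
  let N := LinearMap.range (Fintype.linearCombination A m')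
  have hN : ∀ i, m i ∈ N := fun i => by
    have hi : (i : ℕ) < d := i.2.trans_le (hr.trans_le h)
    refine ⟨Pi.single ⟨i, hi⟩ 1, ?_⟩
    rw [Fintype.linearCombination_apply_single, one_smul]
    exact dif_pos i.2
  let ψ : K ⊗[A] M →ₗ[K] K ⊗[A] (M ⧸ N) := N.mkQ.baseChange K
  have hψ : Function.Surjective ψ := LinearMap.lTensor_surjective _ N.mkQ_surjective
  have hψ0 : ∀ y, ψ y = 0 := fun y => by
    have hy : y ∈ Submodule.span K (Set.range φ) := by rw [hspan, hS]; trivial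
    refine (Submodule.span_le (p := LinearMap.ker ψ)).2 ?_ hy
    rintro _ ⟨i, rfl⟩
    rw [← hm i]
    change (1 : K) ⊗ₜ[A] N.mkQ (m i) = 0
    rw [Submodule.mkQ_apply, (Submodule.Quotient.mk_eq_zero N).2 (hN i), TensorProduct.tmul_zero]
  refine ⟨fun y z => ?_⟩
  obtain ⟨y, rfl⟩ := hψ y
  obtain ⟨z, rfl⟩ := hψ z
  rw [hψ0, hψ0]

variable [IsNoetherianRing A]

/-- At a minimal prime `q` the ring `A_q` is artinian, so an injective endomorphism of a finite
module is surjective there. -/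
theorem exists_smul_mem_range_of_injective (q : PrimeSpectrum A) (hq : q.asIdeal ∈ minimalPrimes A)
    {h : M →ₗ[A] M}
    (hh : Function.Injective (LocalizedModule.map q.asIdeal.primeCompl h)) (m : M) :
    ∃ t ∉ q.asIdeal, t • m ∈ LinearMap.range h := by
  have := Ring.KrullDimLE.of_isLocalization q.asIdeal hq (Localization.AtPrime q.asIdeal)
  have : IsNoetherianRing (Localization.AtPrime q.asIdeal) :=
    IsLocalization.isNoetherianRing q.asIdeal.primeCompl _ ‹_›
  have : IsArtinianRing (Localization.AtPrime q.asIdeal) :=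
    isArtinianRing_iff_isNoetherianRing_krullDimLE_zero.2 ⟨‹_›, ‹_›⟩
  have : Module.Finite (Localization.AtPrime q.asIdeal)
      (LocalizedModule q.asIdeal.primeCompl M) :=
    Module.Finite.of_isLocalizedModule q.asIdeal.primeCompl
      (LocalizedModule.mkLinearMap q.asIdeal.primeCompl M)
  obtain ⟨y, hy⟩ := IsArtinian.surjective_of_injective_endomorphism _ hh (LocalizedModule.mk m 1)
  induction y with
  | h a s =>
    rw [LocalizedModule.map_mk, LocalizedModule.mk_eq] at hy
    obtain ⟨v, hv⟩ := hy
    refine ⟨v * s, (v * s).2, v • a, ?_⟩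
    rw [one_smul] at hv
    rw [Submonoid.smul_def, map_smul, mul_smul]
    exact hv

/-- If `A ^ d` embeds in `M` and also maps to `M` surjectively at a minimal prime `q`, then the
embedding is an isomorphism at `q`. -/
theorem notMem_support_of_injective (q : PrimeSpectrum A) (hq : q.asIdeal ∈ minimalPrimes A)
    {d : ℕ} {f g : (Fin d → A) →ₗ[A] M} (hf : Function.Injective f)
    (hg : q ∉ Module.support A (M ⧸ LinearMap.range g)) :
    q ∉ Module.support A (M ⧸ LinearMap.range f) := by
  rw [Module.mem_support_iff_of_finite, SetLike.not_le_iff_exists] at hg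
  obtain ⟨t, ht, htq⟩ := hg
  have htM : ∀ m : M, t • m ∈ LinearMap.range g := fun m =>
    (Submodule.Quotient.mk_eq_zero _).1
      (Module.mem_annihilator.1 ht (Submodule.Quotient.mk m))
  -- `t • f` factors as `g ∘ h`, and `h` is injective at `q` since `t` is a unit there.
  obtain ⟨h, hh⟩ := Module.projective_lifting_property g.rangeRestrict
    ((t • f).codRestrict (LinearMap.range g) fun a => htM (f a)) g.surjective_rangeRestrict
  have hgh : ∀ a, g (h a) = t • f a := fun a =>
    congrArg Subtype.val (LinearMap.congr_fun hh a)
  have hinj : Function.Injective (LocalizedModule.map q.asIdeal.primeCompl h) := by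
    rw [← LinearMap.ker_eq_bot, LinearMap.ker_eq_bot']
    intro y hy
    induction y with
    | h a s =>
      rw [LocalizedModule.map_mk, ← LocalizedModule.zero_mk s, LocalizedModule.mk_eq] at hy
      obtain ⟨v, hv⟩ := hy
      have h1 : (t * (v * s : q.asIdeal.primeCompl)) • a = 0 := hf (by
        rw [map_smul, map_zero, mul_comm, mul_smul, ← hgh, ← map_smul]
        change g ((v * s) • h a) = 0
        rw [mul_smul, hv, smul_zero, smul_zero, map_zero])
      rw [← LocalizedModule.zero_mk 1, LocalizedModule.mk_eq]
      refine ⟨⟨t, htq⟩ * (v * s), ?_⟩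
      rw [smul_zero, smul_zero, one_smul]
      exact h1
  rw [Module.notMem_support_iff']
  intro y
  obtain ⟨m, rfl⟩ := Submodule.Quotient.mk_surjective _ y
  obtain ⟨b, hb⟩ := htM m
  obtain ⟨w, hwq, a, ha⟩ := exists_smul_mem_range_of_injective q hq hinj b
  refine ⟨w * t, fun hm => (q.2.mem_or_mem hm).elim hwq htq, ?_⟩
  rw [← Submodule.Quotient.mk_smul, Submodule.Quotient.mk_eq_zero]
  refine ⟨t • a, ?_⟩
  rw [map_smul, ← hgh, ha, map_smul, hb, mul_smul]

/-- On a local ring of dimension one, a module with a regular element in the maximal ideal vanishes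
as soon as it vanishes at the minimal primes. -/
theorem subsingleton_of_forall_notMem_support [IsLocalRing A] (hd : dimNat A = 1) {x : A}
    (hxm : x ∈ maximalIdeal A) (hx : IsSMulRegular M x)
    (h : ∀ q : PrimeSpectrum A, q.asIdeal ∈ minimalPrimes A → q ∉ Module.support A M) :
    Subsingleton M := by
  by_contra hnt
  rw [not_subsingleton_iff_nontrivial] at hnt
  obtain ⟨q, hq⟩ := associatedPrimes.nonempty A M
  have hqp : q.IsPrime := hq.isPrime
  obtain ⟨-, m, hm⟩ := isAssociatedPrime_iff.1 hq
  have hxq : x ∉ q := fun hxq => hqp.ne_top ((Ideal.eq_top_iff_one _).2 (by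
    rw [hm, Submodule.mem_colon_singleton, Submodule.mem_bot] at hxq ⊢
    rw [hx.right_eq_zero_of_smul hxq, smul_zero]))
  have hdim : Ring.KrullDimLE 1 A := by
    rw [Ring.krullDimLE_iff]
    have h1 := WithBot.le_coe_unbotD (ringKrullDim A) 0
    rwa [(ENat.toNat_eq_iff one_ne_zero).1 hd] at h1
  refine h ⟨q, hqp⟩ ?_ ?_
  · refine (Ring.krullDimLE_one_iff.1 hdim q hqp).resolve_right fun hmax => hxq ?_
    rwa [eq_maximalIdeal hmax]
  · rw [Module.mem_support_iff_of_finite]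
    rw [← Submodule.annihilator_top]
    exact IsAssociatedPrime.annihilator_le hq

end GenericPoints

/-! ### Regular elements from positive depth -/

section Criterion

open IsLocalRing

theorem exists_isSMulRegular_of_one_le_depth {A : Type u} [CommRing A] [IsLocalRing A]
    {M : Type w} [AddCommGroup M] [Module A M] (h : 1 ≤ depth A M) :
    ∃ x ∈ maximalIdeal A, IsSMulRegular M x := by
  by_contra! hno
  refine absurd h (not_le.2 (lt_of_le_of_lt (b := 0) ?_ zero_lt_one))
  refine iSup₂_le fun rs hrs => ?_
  cases rs with
  | nil => simp
  | cons r rs =>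
    exact absurd ((RingTheory.Sequence.isWeaklyRegular_cons_iff M r rs).1 hrs.2).1
      (hno r (hrs.1 r List.mem_cons_self))

end Criterion

end WilesDefect

end

/-! ### The freeness criterion -/

theorem theorem4 {O : Type v} [CommRing O] [IsDomain O] [IsDiscreteValuationRing O]
    {A : Type u} [CommRing A] [IsLocalRing A] [IsNoetherianRing A]
    (lam : A →+* O) (hA : WilesDefect.IsObj lam) (hG : WilesDefect.IsGorenstein A)
    (M : Type w) [AddCommGroup M] [Module A M] [Module.Finite A M]
    (hM : 1 ≤ WilesDefect.depth A M) :
    (Module.Free A M ↔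
      WilesDefect.wilesDefect hA M ≤
          (WilesDefect.torsionRank hA M : ℤ) * WilesDefect.wilesDefect hA A ∧
        WilesDefect.hsMultiplicity A M ≤
          (WilesDefect.torsionRank hA M : ℝ) * WilesDefect.hsMultiplicity A A) ∧
    (WilesDefect.wilesDefect hA M =
          (WilesDefect.torsionRank hA M : ℤ) * WilesDefect.wilesDefect hA A →
      (∀ q : PrimeSpectrum A, q.asIdeal ∈ minimalPrimes A →
        WilesDefect.rankAt q M ≤ WilesDefect.torsionRank hA M) →
      Module.Free A M) := by
  open WilesDefect in
  have hd := hA.dimNat_eq_one hG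
  obtain ⟨hreg, hB⟩ := hA.exists_isSMulRegular_and_baer hG
  obtain ⟨x, hxm, hxA, hxM⟩ :=
    exists_isSMulRegular_of_two hreg (exists_isSMulRegular_of_one_le_depth hM)
  obtain ⟨s, hsp, hs, hI⟩ := hA.exists_annIdeal_eq_span hxm hxA
  obtain ⟨c, hc⟩ := exists_pow_maximalIdeal_le_span hxm (hB x hxA)
  obtain ⟨e⟩ := nonempty_torsion_equiv (M := M) hA hxm hxM
  have hdef := wilesDefect_le_iff hA hxm hxM hsp hs hI
  -- The defect inequality embeds `A ^ d` in `M` with `x` regular on the cokernel.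
  have hemb : wilesDefect hA M ≤ (torsionRank hA M : ℤ) * wilesDefect hA A →
      ∃ f : (Fin (torsionRank hA M) → A) →ₗ[A] M, Function.Injective f ∧
        IsSMulRegular (M ⧸ LinearMap.range f) x := fun h =>
    exists_injective_of_torsion_le hxm hxA hxM (hB x hxA) hsp hs hI e (hdef.1 h)
  have hfree : ∀ f : (Fin (torsionRank hA M) → A) →ₗ[A] M, Function.Injective f →
      Subsingleton (M ⧸ LinearMap.range f) → Module.Free A M := fun f hf hC =>
    Module.Free.of_equiv (LinearEquiv.ofBijective f
      ⟨hf, LinearMap.range_eq_top.1 (Submodule.Quotient.subsingleton_iff.1 hC)⟩)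
  refine ⟨⟨fun _ => ?_, fun ⟨h, he⟩ => ?_⟩, fun h hq => ?_⟩
  · let b := Module.Free.chooseBasis A M
    obtain ⟨e'⟩ := nonempty_torsion_equiv_of_basis b hs hI
    refine ⟨hdef.2 (torsion_le_range_of_basis b hI), ?_⟩
    rw [hsMultiplicity_eq_of_basis hd hxm hxA hxM hc b, torsionRank_eq_card hA e']
  · obtain ⟨f, hf, hxC⟩ := hemb h
    refine hfree f hf ?_
    by_contra hC
    rw [not_subsingleton_iff_nontrivial] at hC
    have h1 := add_one_le_hsMultiplicity hd hxm hxA hxM hc hf hxC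
    rw [Fintype.card_fin] at h1
    linarith
  · obtain ⟨f, hf, hxC⟩ := hemb h.le
    refine hfree f hf (subsingleton_of_forall_notMem_support hd hxm hxC fun q hqm => ?_)
    obtain ⟨g, hg⟩ := exists_notMem_support_of_rankAt_le q (hq q hqm)
    exact notMem_support_of_injective q hqm hf hg
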